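/- For a multi-index $\alpha\in\mathbb{Z}_{\ge 0}^n$ put $\alpha!=\prod_j\alpha_j!$, $|\alpha|=\sum_j\alpha_j$, $X^\alpha=\prod_j X_j^{\alpha_j}$, and let $\mathbf e_j$ be the $j$-th unit multi-index. An $n$-type tree is a finite planar rooted tree $\mathcal T$ together with a type $\tau(v)\in[n]=\{1,\dots,n\}$ for each vertex $v$; it is called ordered if siblings of smaller types always lie to the left of siblings of larger types. For an internal (non-leaf) vertex $v$ let $\mu(v)\in\mathbb{Z}_{\ge 0}^n$ be the multi-index whose $j$-th component is the number of type $j$ children of $v$. For $i\in[n]$ and $\alpha\in\mathbb{Z}_{\ge 0}^n$ let $\mathbb S_{i,\alpha}$ be the set of all $n$-type trees (with no condition on the order of siblings) whose root has type $i$ and which have exactly $\alpha_j$ leaves of type $j$ for each $j\in[n]$, and let $\vec{\mathbb S}_{i,\alpha}\subseteq\mathbb S_{i,\alpha}$ be the set of ordered ones. For a set $\mathbb S$ of such trees and complex weights $w(\mathcal T)$, the sum $\sum_{\mathcal T\in\mathbb S}w(\mathcal T)$ is understood as the series $\sum_{N\ge 1}\ \sum_{\mathcal T\in\mathbb S,\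 \mathcal T\text{ has }N\text{ vertices}}w(\mathcal T)$, whose inner sums are finite. **(1)** Let $(h_{i,\alpha}: i\in[n],\ \alpha\in\mathbb{Z}_{\ge 0}^n\setminus\{0\})$ be complex numbers such that the power series $$F_i(X)=X_i-\sum_{\alpha\neq 0}h_{i,\alpha}X^\alpha,\qquad i\in[n],$$ converge (absolutely) in an open neighbourhood $U$ of the origin in $\mathbb C^n$, and such that $\sum_{k\ge 0}A^k$ converges, where $A_{i,j}=h_{i,\mathbf e_j}$. Then for all $i$ and $\alpha$ the sum $$g_{i,\alpha}=\sum_{\mathcal T\in\vec{\mathbb S}_{i,\alpha}}\ \prod_{v\text{ internal vertex of }\mathcal T}h_{\tau(v),\mu(v)}$$ converges (absolutely, as a series over $N$), and $F=(F_1,\dots,F_n)$ has an analytic local inverse at the origin with components $F_i^{-1}(X)=\sum_{\alpha\ne 0}g_{i,\alpha}X^\alpha$. That is, $F(0)=0$, and $F$ restricts to a homeomorphism from an open neighbourhood of $0$ contained in $U$ onto an open neighbourhood $V$ of $0$, whose inverse is analytic on $V$ and has as $i$-th component the sum of the series $\sum_{\alpha\neq0}g_{i,\alpha}X^\alpha$,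 which converges absolutely on $V$. **(2)** Let $(H_{i,\alpha}: i\in[n],\ \alpha\in\mathbb{Z}_{\ge 0}^n\setminus\{0\})$ be complex numbers such that the power series $$F_i(X)=X_i-\sum_{\alpha\neq 0}\frac{H_{i,\alpha}}{\alpha!}X^\alpha,\qquad i\in[n],$$ converge (absolutely) in an open neighbourhood $U$ of the origin in $\mathbb C^n$, and such that $\sum_{k\ge 0}A^k$ converges, where $A_{i,j}=H_{i,\mathbf e_j}/\mathbf e_j!=H_{i,\mathbf e_j}$. Then the conclusion of (1) holds for this $F$ with $$g_{i,\alpha}=\sum_{\mathcal T\in\mathbb S_{i,\alpha}}\ \prod_{v\text{ internal vertex of }\mathcal T}\frac{H_{\tau(v),\mu(v)}}{|\mu(v)|!}.$$ -/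

import Mathlib

/-- Finite `n`-type trees: planar rooted trees in which every vertex carries a type in `Fin n`.
`node t m c` is the tree whose root has type `t` and `m` children, the subtrees at the children
being, from left to right, `c 0, …, c (m - 1)`.  The root is a leaf exactly when `m = 0`. -/
inductive TypedTree (n : ℕ) : Type
  | node (t : Fin n) (m : ℕ) (c : Fin m → TypedTree n) : TypedTree n

namespace TypedTree

variable {n : ℕ}

def rootType : TypedTree n → Fin n
  | node t _ _ => t

/-- The multi-index counting the children of each type, for a vertex with child subtrees `c`. -/
def childType {m : ℕ} (c : Fin m → TypedTree n) : Fin n → ℕ :=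
  fun j => (Finset.univ.filter fun k => (c k).rootType = j).card

/-- The number of vertices. -/
def size : TypedTree n → ℕ
  | node _ _ c => 1 + ∑ k, (c k).size

/-- The multi-index counting the leaves of each type. -/
def leafType : TypedTree n → Fin n → ℕ
  | node t m c => if m = 0 then Pi.single t 1 else ∑ k, (c k).leafType

/-- A tree is ordered if siblings of smaller type always lie to the left of siblings of larger
type. -/
def IsOrdered : TypedTree n → Prop
  | node _ _ c => Monotone (fun k => (c k).rootType) ∧ ∀ k, (c k).IsOrdered

/-- The product, over all internal vertices `v`, of `w (type of v) (child multi-index of v)`. -/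
def weight (w : Fin n → (Fin n → ℕ) → ℂ) : TypedTree n → ℂ
  | node t m c => if m = 0 then 1 else w t (childType c) * ∏ k, (c k).weight w

theorem one_le_size (T : TypedTree n) : 1 ≤ T.size := by
  cases T
  simp [size]

theorem finite_size_le (s : ℕ) : {T : TypedTree n | T.size ≤ s}.Finite := by
  induction s with
  | zero =>
    refine Set.finite_empty.subset fun T hT => ?_
    have := T.one_le_size
    simp only [Set.mem_ofPred_eq] at hT
    omega
  | succ s ih =>
    have hfin : ∀ m : ℕ, {c : Fin m → TypedTree n | ∀ k, (c k).size ≤ s}.Finite :=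
      fun m => Set.Finite.pi' fun _ => ih
    refine (Set.Finite.biUnion (Set.finite_Iic s) fun m _ =>
      Set.finite_iUnion fun t : Fin n => (hfin m).image (node t m)).subset ?_
    rintro ⟨t, m, c⟩ hT
    simp only [Set.mem_ofPred_eq, size] at hT
    simp only [Set.mem_iUnion, Set.mem_Iic]
    refine ⟨m, ?_, t, c, fun k => ?_, rfl⟩
    · have : ∑ _k : Fin m, 1 ≤ ∑ k, (c k).size := Finset.sum_le_sum fun k _ => (c k).one_le_size
      simp only [Finset.sum_const, Finset.card_univ, Fintype.card_fin, smul_eq_mul,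
        mul_one] at this
      omega
    · have : (c k).size ≤ ∑ k, (c k).size :=
        Finset.single_le_sum (f := fun k => (c k).size) (fun _ _ => Nat.zero_le _)
          (Finset.mem_univ k)
      omega

theorem finite_size_eq (s : ℕ) : {T : TypedTree n | T.size = s}.Finite :=
  (finite_size_le s).subset fun _ hT => le_of_eq hT

/-- The (finite) set of all `n`-type trees with exactly `N` vertices. -/
noncomputable def ofSize (n N : ℕ) : Finset (TypedTree n) :=
  (finite_size_eq (n := n) N).toFinset

/-- All `n`-type trees with root type `i` and leaf type `α`, siblings being in any order. -/
def unorderedTrees (i : Fin n) (α : Fin n → ℕ) : Set (TypedTree n) :=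
  {T | T.rootType = i ∧ T.leafType = α}

/-- The ordered `n`-type trees with root type `i` and leaf type `α`. -/
def orderedTrees (i : Fin n) (α : Fin n → ℕ) : Set (TypedTree n) :=
  {T | T.IsOrdered ∧ T.rootType = i ∧ T.leafType = α}

open Classical in
/-- The sum of the weights of the trees in `S` is `a`.  There may be infinitely many trees in `S`
(with chains of one-child vertices of any length), and under the hypotheses of interest the family
of their weights need not be absolutely summable; the sum is taken by number of vertices,
`∑_N ∑_{T ∈ S, T has N vertices} weight T`, where each inner sum is finite. -/
def HasTreeSum (S : Set (TypedTree n)) (w : Fin n → (Fin n → ℕ) → ℂ) (a : ℂ) : Prop :=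
  HasSum (fun N : ℕ => ∑ T ∈ (ofSize n N).filter (fun T => T ∈ S), T.weight w) a

end TypedTree

namespace SeriesInversion

/-- The monomial `x ^ α`. -/
def monom {n : ℕ} (x : Fin n → ℂ) (α : Fin n → ℕ) : ℂ := ∏ j, x j ^ α j

/-- Convergence on `U` of all the power series `∑_{α ≠ 0} h i α x ^ α`. -/
def ConvergesOn {n : ℕ} (h : Fin n → (Fin n → ℕ) → ℂ) (U : Set (Fin n → ℂ)) : Prop :=
  ∀ x ∈ U, ∀ i, Summable fun α : {α : Fin n → ℕ // α ≠ 0} => h i α * monom x α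

/-- The map with components `x i - ∑_{α ≠ 0} h i α x ^ α`. -/
noncomputable def seriesMap {n : ℕ} (h : Fin n → (Fin n → ℕ) → ℂ) (x : Fin n → ℂ) : Fin n → ℂ :=
  fun i => x i - ∑' α : {α : Fin n → ℕ // α ≠ 0}, h i α * monom x α

/-- The matrix of linear coefficients, `A i j = h i e_j`. -/
def linearPart {n : ℕ} (h : Fin n → (Fin n → ℕ) → ℂ) : Matrix (Fin n) (Fin n) ℂ :=
  Matrix.of fun i j => h i (Pi.single j 1)

/-- The series `∑_k A ^ k` converges. -/
def NeumannConverges {n : ℕ} (A : Matrix (Fin n) (Fin n) ℂ) : Prop :=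
  ∃ S : Matrix (Fin n) (Fin n) ℂ,
    Filter.Tendsto (fun K => ∑ k ∈ Finset.range K, A ^ k) Filter.atTop (nhds S)

/-- `F`, considered on `U`, restricts to a homeomorphism `e` fixing the origin from an open
neighbourhood of the origin in `U` onto an open neighbourhood of the origin; the inverse of `e` is
analytic, and its components are the sums of the power series `∑_{α ≠ 0} g i α y ^ α`. -/
def HasAnalyticInverse {n : ℕ} (F : (Fin n → ℂ) → Fin n → ℂ) (U : Set (Fin n → ℂ))
    (g : Fin n → (Fin n → ℕ) → ℂ) : Prop :=
  ∃ e : OpenPartialHomeomorph (Fin n → ℂ) (Fin n → ℂ),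
    (0 : Fin n → ℂ) ∈ e.source ∧ e.source ⊆ U ∧ Set.EqOn e F e.source ∧ e 0 = 0 ∧
    AnalyticOnNhd ℂ e.symm e.target ∧
    ∀ y ∈ e.target, ∀ i,
      HasSum (fun α : {α : Fin n → ℕ // α ≠ 0} => g i α * monom y α) (e.symm y i)

/-- `α! = ∏ j, (α j)!`. -/
def multiFactorial {n : ℕ} (α : Fin n → ℕ) : ℕ := ∏ j, (α j).factorial

end SeriesInversion

/-! Mark each vertex by a variable `t` and each leaf of type `i` by `X i`. Finitely many trees have
a given size, so the trees with root type `i` give a power series `G i` in `t` with polynomial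
coefficients. Deleting the root yields `G i = t * (X i + ∑_{β ≠ 0} h i β * G ^ β)`. At `t = 1` this
reads `F (G) = X`, so the sum of `G` at `t = 1` should invert `F`.

The analytic content is absolute convergence at `t = 1`. The linear terms are removed by variation
of constants: with `A` the linear part, the coefficients of `G` are the convolution of the powers of
`A` with the remaining terms, and `∑ ‖A ^ k‖` is finite because convergence of `∑ A ^ k` forces `A ^
k → 0`. The remaining terms are `X`, of norm `r`, and terms of degree at least two, which are `O(s ^
2)` when `G` has norm at most `s`. For small `s` and smaller `r` the bound `s` on partial sums
therefore reproduces itself (`IsSolution.partialNorm_le`). Interchanging sums then gives a right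
inverse of `F` near the origin, analytic with the tree sums as coefficients; since `1 - A` is
invertible, the inverse function theorem identifies it with the local inverse.

Ordered and unordered trees differ only in how `h i β` is distributed over the tuples of child types
with count `β`: all on the monotone tuple, or equally on all tuples. -/

/-! ### Tuples of types and their multi-indices -/

namespace SeriesInversion

open Finset

variable {n m : ℕ}

/-- The multi-index counting how often each value is taken by a tuple. -/
def fiberCard (j : Fin m → Fin n) : Fin n → ℕ :=
  fun l => (univ.filter fun k => j k = l).card

theorem sum_fiberCard (j : Fin m → Fin n) : ∑ l, fiberCard j l = m := by
  have h := (card_eq_sum_card_fiberwise (f := j) (s := univ) (t := univ) (by simp)).symm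
  rwa [card_univ, Fintype.card_fin] at h

theorem fiberCard_mem (j : Fin m → Fin n) : fiberCard j ∈ piAntidiag univ m := by
  simp [sum_fiberCard]

theorem prod_comp_eq_prod_pow {R : Type*} [CommMonoid R] (f : Fin n → R) (j : Fin m → Fin n) :
    ∏ k, f (j k) = ∏ l, f l ^ fiberCard j l := by
  rw [← prod_fiberwise (s := univ) (g := j)]
  refine prod_congr rfl fun l _ => ?_
  rw [prod_congr rfl (g := fun _ => f l) (by simp +contextual), prod_const]
  rfl

theorem count_ofFn (j : Fin m → Fin n) (l : Fin n) : (List.ofFn j).count l = fiberCard j l := by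
  rw [List.ofFn_eq_map, ← Multiset.coe_count, ← Multiset.map_coe, Multiset.count_map]
  simp only [eq_comm (a := l)]
  rfl

theorem monotone_ext_of_fiberCard {j j' : Fin m → Fin n} (hj : Monotone j) (hj' : Monotone j')
    (h : fiberCard j = fiberCard j') : j = j' := by
  have hp : (List.ofFn j).Perm (List.ofFn j') := by
    rw [List.perm_iff_count]
    intro l
    rw [count_ofFn, count_ofFn, h]
  have := hp.eq_of_sortedLE (List.sortedLE_ofFn_iff.2 hj) (List.sortedLE_ofFn_iff.2 hj')
  exact List.ofFn_injective this

theorem sum_tuples {M : Type*} [AddCommMonoid M] (f : (Fin m → Fin n) → M) :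
    ∑ j, f j = ∑ β ∈ piAntidiag univ m, ∑ j with fiberCard j = β, f j :=
  (sum_fiberwise_of_maps_to (fun j _ => fiberCard_mem j) f).symm

/-- Compare the coefficients of `X ^ β` in two expansions of `(∑ X l) ^ m`: the multinomial theorem,
and the distributive law over all tuples. -/
theorem card_fiberCard_eq {β : Fin n → ℕ} (h : β ∈ piAntidiag univ m) :
    (univ.filter fun j : Fin m → Fin n => fiberCard j = β).card = Nat.multinomial univ β := by
  have h1 := sum_pow_eq_sum_piAntidiag univ
    (fun l : Fin n => (MvPolynomial.X l : MvPolynomial (Fin n) ℤ)) m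
  have h2 : (∑ l : Fin n, (MvPolynomial.X l : MvPolynomial (Fin n) ℤ)) ^ m
      = ∑ j : Fin m → Fin n, ∏ l, MvPolynomial.X l ^ fiberCard j l := by
    simp_rw [← prod_comp_eq_prod_pow]
    rw [← Fintype.piFinset_univ, ← prod_univ_sum]
    simp
  have h3 : ∀ γ : Fin n → ℕ, ∏ l, (MvPolynomial.X l : MvPolynomial (Fin n) ℤ) ^ γ l
      = MvPolynomial.monomial (Finsupp.equivFunOnFinite.symm γ) 1 := by
    intro γ
    rw [MvPolynomial.monomial_eq, Finsupp.prod_fintype _ _ (by simp)]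
    simp
  rw [h2] at h1
  have h4 := congrArg (MvPolynomial.coeff (Finsupp.equivFunOnFinite.symm β)) h1
  simp only [h3, MvPolynomial.coeff_sum, MvPolynomial.coeff_monomial,
    ← nsmul_eq_mul, MvPolynomial.coeff_smul, EmbeddingLike.apply_eq_iff_eq] at h4
  simpa [h, -mem_piAntidiag] using h4

theorem exists_monotone_fiberCard {β : Fin n → ℕ} (h : β ∈ piAntidiag univ m) :
    ∃ j : Fin m → Fin n, Monotone j ∧ fiberCard j = β := by
  obtain ⟨j, hj⟩ : (univ.filter fun j : Fin m → Fin n => fiberCard j = β).Nonempty := by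
    rw [← card_pos, card_fiberCard_eq h]
    exact Nat.multinomial_pos _ _
  refine ⟨j ∘ Tuple.sort j, Tuple.monotone_sort j, ?_⟩
  rw [← (mem_filter.1 hj).2]
  funext l
  exact card_equiv (Tuple.sort j) (by simp)

/-- Each multi-index of degree `m` is counted by exactly one monotone tuple, obtained by sorting. -/
theorem sum_monotone_tuples {M : Type*} [AddCommMonoid M] (f : (Fin n → ℕ) → M) :
    (∑ j : Fin m → Fin n, open Classical in if Monotone j then f (fiberCard j) else 0)
      = ∑ β ∈ piAntidiag univ m, f β := by
  classical
  rw [← sum_filter]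
  refine sum_bij (fun j _ => fiberCard j) (fun j _ => fiberCard_mem j) ?_ ?_ (fun _ _ => rfl)
  · intro j hj j' hj' h
    exact monotone_ext_of_fiberCard (by simpa using hj) (by simpa using hj') h
  · intro β hβ
    obtain ⟨j, hj, rfl⟩ := exists_monotone_fiberCard hβ
    exact ⟨j, by simpa using hj, rfl⟩

end SeriesInversion

/-! ### Generating series of trees by number of vertices -/

namespace TypedTree

open Finset PowerSeries SeriesInversion

variable {n : ℕ} {R : Type*} [CommRing R]

theorem mem_ofSize {N : ℕ} {T : TypedTree n} : T ∈ ofSize n N ↔ T.size = N := by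
  simp [ofSize]

/-- The product over all vertices, leaves included, of weights which depend on the type of the
vertex and the tuple of the types of its children. -/
def vertexProd (W : Fin n → ∀ m, (Fin m → Fin n) → R) : TypedTree n → R
  | node t m c => W t m (fun k => (c k).rootType) * ∏ k, (c k).vertexProd W

/-- The generating series, by number of vertices, of the trees with root type `i`. -/
noncomputable def treeSeries (W : Fin n → ∀ m, (Fin m → Fin n) → R) (i : Fin n) : R⟦X⟧ :=
  PowerSeries.mk fun N => ∑ T ∈ ofSize n N with T.rootType = i, T.vertexProd W

theorem coeff_treeSeries (W : Fin n → ∀ m, (Fin m → Fin n) → R) (i : Fin n) (N : ℕ) :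
    coeff N (treeSeries W i) = ∑ T ∈ ofSize n N with T.rootType = i, T.vertexProd W :=
  coeff_mk _ _

theorem coeff_zero_treeSeries (W : Fin n → ∀ m, (Fin m → Fin n) → R) (i : Fin n) :
    coeff 0 (treeSeries W i) = 0 := by
  rw [coeff_treeSeries]
  refine sum_eq_zero fun T hT => ?_
  have h := T.one_le_size
  rw [mem_ofSize.1 (mem_filter.1 hT).1] at h
  omega

/-- Delete the root. Each of the `m` subtrees has at least one vertex, whence `m ≤ N`. -/
theorem sum_ofSize_succ (i : Fin n) (N : ℕ) (f : TypedTree n → R) :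
    ∑ T ∈ ofSize n (N + 1) with T.rootType = i, f T
      = ∑ m ∈ range (N + 1), ∑ l ∈ finsuppAntidiag (univ : Finset (Fin m)) N,
          ∑ c ∈ Fintype.piFinset fun k => ofSize n (l k), f (node i m c) := by
  classical
  simp_rw [sum_sigma']
  symm
  refine sum_bij (fun p _ => node i p.1 p.2.2) ?_ ?_ ?_ (fun _ _ => rfl)
  · rintro ⟨m, l, c⟩ hp
    simp only [mem_sigma, mem_range, mem_finsuppAntidiag, Fintype.mem_piFinset, mem_ofSize] at hp
    refine mem_filter.2 ⟨mem_ofSize.2 ?_, rfl⟩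
    rw [size, sum_congr rfl fun k _ => hp.2.2 k, hp.2.1.1, add_comm]
  · rintro ⟨m, l, c⟩ hp ⟨m', l', c'⟩ hp' h
    simp only [mem_sigma, mem_range, mem_finsuppAntidiag, Fintype.mem_piFinset, mem_ofSize]
      at hp hp'
    simp only [node.injEq, true_and] at h
    obtain ⟨rfl, h⟩ := h
    obtain rfl := eq_of_heq h
    have : l = l' := by
      ext k
      rw [← hp.2.2 k, hp'.2.2 k]
    rw [this]
  · rintro ⟨t, m, c⟩ hT
    obtain ⟨hs, rfl⟩ := mem_filter.1 hT
    rw [mem_ofSize, size] at hs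
    have hm : m ≤ ∑ k, (c k).size := by
      simpa using sum_le_sum fun k (_ : k ∈ (univ : Finset (Fin m))) => (c k).one_le_size
    refine ⟨⟨m, Finsupp.equivFunOnFinite.symm fun k => (c k).size, c⟩, ?_, rfl⟩
    simp only [mem_sigma, mem_range, mem_finsuppAntidiag, Fintype.mem_piFinset, mem_ofSize]
    refine ⟨by omega, ⟨?_, subset_univ _⟩, fun k => by simp⟩
    simp only [Finsupp.equivFunOnFinite_symm_apply_apply]
    omega

theorem coeff_succ_treeSeries (W : Fin n → ∀ m, (Fin m → Fin n) → R) (i : Fin n) (N : ℕ) :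
    coeff (N + 1) (treeSeries W i) = ∑ m ∈ range (N + 1), ∑ j : Fin m → Fin n,
      W i m j * coeff N (∏ k, treeSeries W (j k)) := by
  rw [coeff_treeSeries, sum_ofSize_succ]
  refine sum_congr rfl fun m _ => ?_
  simp_rw [PowerSeries.coeff_prod, mul_sum]
  rw [sum_comm]
  refine sum_congr rfl fun l _ => ?_
  simp_rw [coeff_treeSeries, prod_univ_sum, mul_sum]
  rw [← sum_fiberwise (s := Fintype.piFinset _) (g := fun c k => (c k).rootType)]
  refine sum_congr rfl fun j _ => ?_
  refine sum_congr ?_ fun c hc => ?_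
  · ext c
    simp [Fintype.mem_piFinset, funext_iff, forall_and]
  · have : (fun k => (c k).rootType) = j := by
      funext k
      exact (mem_filter.1 (Fintype.mem_piFinset.1 hc k)).2
    rw [vertexProd, this]

end TypedTree

/-! ### The functional equation of the tree series -/

namespace SeriesInversion

open Finset PowerSeries TypedTree

variable {n : ℕ} {R : Type*} [CommRing R]

/-- The series `G i`, in a variable `t`, have no constant term and solve
`G i = t * ∑ β, w i β * G ^ β`. -/
structure IsSolution (w : Fin n → (Fin n → ℕ) → R) (G : Fin n → R⟦X⟧) : Prop where
  coeff_zero : ∀ i, coeff 0 (G i) = 0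
  coeff_succ : ∀ i N, coeff (N + 1) (G i)
    = ∑ m ∈ range (N + 1), ∑ β ∈ piAntidiag univ m, w i β * coeff N (∏ l, G l ^ β l)

/-- The product of the series of the children does not depend on their order, so only the total of
`W` over all tuples with the same count matters. This treats ordered and unordered trees at once. -/
theorem isSolution_treeSeries {W : Fin n → ∀ m, (Fin m → Fin n) → R} {w : Fin n → (Fin n → ℕ) → R}
    (h : ∀ i m, ∀ β ∈ piAntidiag univ m, ∑ j with fiberCard j = β, W i m j = w i β) :
    IsSolution w (treeSeries W) where
  coeff_zero := coeff_zero_treeSeries W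
  coeff_succ i N := by
    rw [coeff_succ_treeSeries]
    refine sum_congr rfl fun m _ => ?_
    rw [sum_tuples]
    refine sum_congr rfl fun β hβ => ?_
    rw [← h i m β hβ, sum_mul]
    refine sum_congr rfl fun j hj => ?_
    rw [prod_comp_eq_prod_pow, (mem_filter.1 hj).2]

/-- Used to specialise the variables `X` to a point of `ℂ ^ n`. -/
theorem IsSolution.map {S : Type*} [CommRing S] (φ : R →+* S) {w : Fin n → (Fin n → ℕ) → R}
    {G : Fin n → R⟦X⟧} (h : IsSolution w G) :
    IsSolution (fun i β => φ (w i β)) (fun i => PowerSeries.map φ (G i)) where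
  coeff_zero i := by rw [coeff_map, h.coeff_zero, map_zero]
  coeff_succ i N := by
    simp_rw [coeff_map, h.coeff_succ, map_sum, map_mul, ← map_pow, ← map_prod, coeff_map]

end SeriesInversion

/-! ### A priori bounds for solutions -/

namespace SeriesInversion

open Finset PowerSeries

variable {n : ℕ} {R : Type*} [CommRing R]

theorem sum_piAntidiag_one {M : Type*} [AddCommMonoid M] (f : (Fin n → ℕ) → M) :
    ∑ β ∈ piAntidiag univ 1, f β = ∑ j, f (Pi.single j 1) := by
  rw [← sum_monotone_tuples, ← (Equiv.funUnique (Fin 1) (Fin n)).symm.sum_comp]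
  refine sum_congr rfl fun j _ => ?_
  rw [if_pos (Subsingleton.monotone _)]
  congr 1
  funext l
  simp [fiberCard, Pi.single_apply, eq_comm (a := l), filter_const, apply_ite]

/-- The triangle `p.1 + p.2 < M` lies in the square of side `M`. -/
theorem sum_antidiagonal_mul_le {a b : ℕ → ℝ} (ha : ∀ k, 0 ≤ a k) (hb : ∀ k, 0 ≤ b k) (M : ℕ) :
    ∑ N ∈ range M, ∑ p ∈ antidiagonal N, a p.1 * b p.2
      ≤ (∑ k ∈ range M, a k) * ∑ k ∈ range M, b k := by
  rw [sum_mul_sum, ← sum_product']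
  refine le_trans (le_of_eq ?_) (sum_le_sum_of_subset_of_nonneg
    (filter_subset (fun p : ℕ × ℕ => p.1 + p.2 < M) _)
    fun p _ _ => mul_nonneg (ha p.1) (hb p.2))
  rw [← sum_fiberwise_of_maps_to (g := fun p : ℕ × ℕ => p.1 + p.2) (t := range M) (by simp)]
  refine sum_congr rfl fun N hN => sum_congr ?_ fun _ _ => rfl
  ext p
  simp only [HasAntidiagonal.mem_antidiagonal, mem_filter, mem_product, mem_range] at hN ⊢
  omega

/-- The sum of the norms of the coefficients of degree less than `M`. -/
noncomputable def partialNorm (ν : RingSeminorm R) (M : ℕ) (f : R⟦X⟧) : ℝ :=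
  ∑ N ∈ range M, ν (coeff N f)

variable {ν : RingSeminorm R}

theorem partialNorm_nonneg (M : ℕ) (f : R⟦X⟧) : 0 ≤ partialNorm ν M f :=
  sum_nonneg fun _ _ => apply_nonneg _ _

theorem partialNorm_mul_le (M : ℕ) (f g : R⟦X⟧) :
    partialNorm ν M (f * g) ≤ partialNorm ν M f * partialNorm ν M g := by
  refine le_trans (sum_le_sum fun N _ => ?_) (sum_antidiagonal_mul_le
    (a := fun N => ν (coeff N f)) (b := fun N => ν (coeff N g))
    (fun _ => apply_nonneg _ _) (fun _ => apply_nonneg _ _) M)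
  rw [coeff_mul]
  refine (le_sum_of_subadditive ν (map_zero ν).le (map_add_le_add ν) _ _).trans ?_
  exact sum_le_sum fun p _ => map_mul_le_mul ν _ _

theorem partialNorm_one_le (h1 : ν 1 ≤ 1) (M : ℕ) : partialNorm ν M (1 : R⟦X⟧) ≤ 1 := by
  have : ∀ N, ν (coeff N (1 : R⟦X⟧)) = if N = 0 then ν 1 else 0 := by
    intro N
    rw [coeff_one, apply_ite ν, map_zero]
  simp only [partialNorm, this, sum_ite_eq', mem_range]
  split_ifs <;> simp [h1]

theorem partialNorm_prod_pow_le (h1 : ν 1 ≤ 1) (M : ℕ) (G : Fin n → R⟦X⟧) {s : ℝ}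
    (hs : ∀ i, partialNorm ν M (G i) ≤ s) (β : Fin n → ℕ) :
    partialNorm ν M (∏ l, G l ^ β l) ≤ s ^ ∑ l, β l := by
  have hpow : ∀ i k, partialNorm ν M (G i ^ k) ≤ s ^ k := by
    intro i k
    induction k with
    | zero => simpa using partialNorm_one_le h1 M
    | succ k ih =>
      rw [pow_succ, pow_succ]
      exact (partialNorm_mul_le _ _ _).trans (mul_le_mul ih (hs i) (partialNorm_nonneg _ _)
        ((partialNorm_nonneg _ _).trans ih))
  rw [← prod_pow_eq_pow_sum]
  induction (univ : Finset (Fin n)) using Finset.induction_on with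
  | empty => simpa using partialNorm_one_le h1 M
  | insert a t ha ih =>
    rw [prod_insert ha, prod_insert ha]
    exact (partialNorm_mul_le _ _ _).trans (mul_le_mul (hpow _ _) ih (partialNorm_nonneg _ _)
      ((partialNorm_nonneg M (G a ^ β a)).trans (hpow a (β a))))

variable [Algebra ℂ R]

/-- The part of degree at least two in the equations for the coefficients of a solution. -/
noncomputable def higherTerm (h : Fin n → (Fin n → ℕ) → ℂ) (G : Fin n → R⟦X⟧) (N : ℕ)
    (i : Fin n) : R :=
  ∑ m ∈ Ico 2 (N + 1), ∑ β ∈ piAntidiag univ m, h i β • coeff N (∏ l, G l ^ β l)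

/-- Split by the degree of `β`: degree zero contributes only for `N = 0`, degree one is the matrix
`linearPart h`. -/
theorem IsSolution.coeff_succ_eq {h : Fin n → (Fin n → ℕ) → ℂ} {w : Fin n → (Fin n → ℕ) → R}
    {G : Fin n → R⟦X⟧} (hG : IsSolution w G) (hw : ∀ i β, β ≠ 0 → w i β = algebraMap ℂ R (h i β))
    (N : ℕ) (i : Fin n) :
    coeff (N + 1) (G i) = ∑ j, linearPart h i j • coeff N (G j)
      + ((if N = 0 then w i 0 else 0) + higherTerm h G N i) := by
  have hne : ∀ m, ∀ β ∈ piAntidiag (univ : Finset (Fin n)) m, m ≠ 0 → β ≠ 0 := by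
    rintro m β hβ hm rfl
    simp at hβ
    exact hm hβ.symm
  have hz : ∑ β ∈ piAntidiag univ 0, w i β * coeff N (∏ l, G l ^ β l)
      = if N = 0 then w i 0 else 0 := by
    simp [coeff_one]
  have hone : ∑ β ∈ piAntidiag univ 1, w i β * coeff N (∏ l, G l ^ β l)
      = ∑ j, linearPart h i j • coeff N (G j) := by
    rw [sum_piAntidiag_one]
    refine sum_congr rfl fun j _ => ?_
    rw [hw i _ (by simp), ← Algebra.smul_def]
    congr 2
    rw [prod_eq_single j] <;> simp +contextual
  have hh : ∑ m ∈ Ico 2 (N + 1), ∑ β ∈ piAntidiag univ m, w i β * coeff N (∏ l, G l ^ β l)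
      = higherTerm h G N i := by
    refine sum_congr rfl fun m hm => sum_congr rfl fun β hβ => ?_
    rw [hw i β (hne m β hβ (by have := (mem_Ico.1 hm).1; omega)), Algebra.smul_def]
  rw [hG.coeff_succ, range_eq_Ico, sum_eq_sum_Ico_succ_bot (by omega), hz, ← hh]
  rcases N with _ | N
  · simp [hG.coeff_zero]
  · rw [sum_eq_sum_Ico_succ_bot (by omega), hone]
    abel

/-- Variation of constants for an inhomogeneous linear recurrence. -/
theorem eq_sum_antidiagonal_of_recurrence {A : Matrix (Fin n) (Fin n) ℂ} {g u : ℕ → Fin n → R}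
    (h0 : ∀ i, g 0 i = 0) (hs : ∀ N i, g (N + 1) i = ∑ j, A i j • g N j + u N i) (N : ℕ)
    (i : Fin n) :
    g (N + 1) i = ∑ p ∈ antidiagonal N, ∑ j, (A ^ p.1) i j • u p.2 j := by
  induction N generalizing i with
  | zero => simp [hs, h0, Matrix.one_apply]
  | succ N ih =>
    rw [hs, Nat.sum_antidiagonal_succ, add_comm]
    congr 1
    · simp [Matrix.one_apply]
    · simp_rw [ih, smul_sum]
      rw [sum_comm]
      refine sum_congr rfl fun p _ => ?_
      rw [sum_comm]
      refine sum_congr rfl fun j _ => ?_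
      simp_rw [pow_succ', Matrix.mul_apply, sum_smul, smul_smul]

/-- Induction on `M`: coefficients up to `t ^ (M + 1)` depend only on those up to `t ^ M`. If these
have total norm at most `s`, the higher terms have norm at most `K * (s / ρ) ^ 2`, and convolution
with the powers of the linear part costs a factor `C`; `hle` closes the loop. The seminorm is
abstract because the bound serves both for polynomials and for numbers. -/
theorem IsSolution.partialNorm_le {h : Fin n → (Fin n → ℕ) → ℂ} {w : Fin n → (Fin n → ℕ) → R}
    {G : Fin n → R⟦X⟧} (hG : IsSolution w G) (hw : ∀ i β, β ≠ 0 → w i β = algebraMap ℂ R (h i β))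
    (h1 : ν 1 ≤ 1) (hν : ∀ (c : ℂ) x, ν (c • x) ≤ ‖c‖ * ν x) {C K r s ρ : ℝ}
    (hC : ∀ M, ∑ k ∈ range M, ∑ i, ∑ j, ‖(linearPart h ^ k) i j‖ ≤ C)
    (hr : ∑ i, ν (w i 0) ≤ r)
    (hK : ∀ M, ∑ i, ∑ m ∈ Ico 2 M, ∑ β ∈ piAntidiag univ m, ‖h i β‖ * ρ ^ m ≤ K)
    (hs : 0 ≤ s) (hρ : 0 < ρ) (hsρ : s ≤ ρ) (hle : C * (r + K * (s / ρ) ^ 2) ≤ s) (M : ℕ) :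
    ∑ i, partialNorm ν M (G i) ≤ s := by
  have hνsum : ∀ {ι : Type} (t : Finset ι) (f : ι → R), ν (∑ a ∈ t, f a) ≤ ∑ a ∈ t, ν (f a) :=
    fun t f => le_sum_of_subadditive ν (map_zero ν).le (map_add_le_add ν) t f
  have hC0 : 0 ≤ C := by simpa using hC 0
  have hr0 : 0 ≤ r := (sum_nonneg fun _ _ => apply_nonneg _ _).trans hr
  rcases M with _ | M
  · simpa [partialNorm] using hs
  induction M with
  | zero => simpa [partialNorm, hG.coeff_zero] using hs
  | succ M ih =>
    set u : ℕ → Fin n → R := fun N i => (if N = 0 then w i 0 else 0) + higherTerm h G N i with hu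
    have hrec := eq_sum_antidiagonal_of_recurrence (A := linearPart h)
      (g := fun N i => coeff N (G i)) (u := u) hG.coeff_zero (fun N i => hG.coeff_succ_eq hw N i)
    set a : ℕ → ℝ := fun k => ∑ i, ∑ j, ‖(linearPart h ^ k) i j‖
    set b : ℕ → ℝ := fun N => ∑ j, ν (u N j)
    have ha : ∀ k, 0 ≤ a k := fun k => by positivity
    have hb : ∀ k, 0 ≤ b k := fun k => sum_nonneg fun _ _ => apply_nonneg _ _
    have hstep : ∀ N, ∑ i, ν (coeff (N + 1) (G i)) ≤ ∑ p ∈ antidiagonal N, a p.1 * b p.2 := by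
      intro N
      calc ∑ i, ν (coeff (N + 1) (G i))
          ≤ ∑ i, ∑ p ∈ antidiagonal N, ∑ j, ‖(linearPart h ^ p.1) i j‖ * ν (u p.2 j) := by
            refine sum_le_sum fun i _ => ?_
            rw [hrec]
            refine (hνsum _ _).trans (sum_le_sum fun p _ => ?_)
            exact (hνsum _ _).trans (sum_le_sum fun j _ => hν _ _)
        _ = ∑ p ∈ antidiagonal N, ∑ i, ∑ j, ‖(linearPart h ^ p.1) i j‖ * ν (u p.2 j) := sum_comm
        _ ≤ ∑ p ∈ antidiagonal N, a p.1 * b p.2 := by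
            refine sum_le_sum fun p _ => ?_
            rw [sum_mul]
            refine sum_le_sum fun i _ => ?_
            rw [sum_mul]
            refine sum_le_sum fun j _ => ?_
            refine mul_le_mul_of_nonneg_left ?_ (norm_nonneg _)
            exact single_le_sum (f := fun j => ν (u p.2 j)) (fun _ _ => apply_nonneg _ _)
              (mem_univ j)
    have hhigh : ∑ N ∈ range (M + 1), ∑ i, ν (higherTerm h G N i) ≤ K * (s / ρ) ^ 2 := by
      have hsi : ∀ i, partialNorm ν (M + 1) (G i) ≤ s := fun i =>
        (single_le_sum (f := fun i => partialNorm ν (M + 1) (G i))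
          (fun _ _ => partialNorm_nonneg _ _) (mem_univ i)).trans ih
      rw [sum_comm]
      refine le_trans ?_ (mul_le_mul_of_nonneg_right (hK (M + 1)) (by positivity))
      rw [sum_mul]
      refine sum_le_sum fun i _ => ?_
      calc ∑ N ∈ range (M + 1), ν (higherTerm h G N i)
          ≤ ∑ N ∈ range (M + 1), ∑ m ∈ Ico 2 (M + 1), ∑ β ∈ piAntidiag univ m,
              ‖h i β‖ * ν (coeff N (∏ l, G l ^ β l)) := by
            refine sum_le_sum fun N hN => ?_
            refine (hνsum _ _).trans ?_
            refine (sum_le_sum fun m _ => (hνsum _ _).trans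
              (sum_le_sum fun β _ => hν _ _)).trans ?_
            refine sum_le_sum_of_subset_of_nonneg (Ico_subset_Ico le_rfl ?_) ?_
            · have := mem_range.1 hN
              omega
            · intro m _ _
              exact sum_nonneg fun β _ => mul_nonneg (norm_nonneg _) (apply_nonneg _ _)
        _ = ∑ m ∈ Ico 2 (M + 1), ∑ β ∈ piAntidiag univ m,
              ‖h i β‖ * partialNorm ν (M + 1) (∏ l, G l ^ β l) := by
            rw [sum_comm]
            refine sum_congr rfl fun m _ => ?_
            rw [sum_comm]
            refine sum_congr rfl fun β _ => ?_
            rw [partialNorm, mul_sum]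
        _ ≤ (∑ m ∈ Ico 2 (M + 1), ∑ β ∈ piAntidiag univ m, ‖h i β‖ * ρ ^ m) * (s / ρ) ^ 2 := by
            rw [sum_mul]
            refine sum_le_sum fun m hm => ?_
            rw [sum_mul]
            refine sum_le_sum fun β hβ => ?_
            have hβm : ∑ l, β l = m := (mem_piAntidiag.1 hβ).1
            rw [mul_assoc]
            refine mul_le_mul_of_nonneg_left ?_ (norm_nonneg _)
            refine (partialNorm_prod_pow_le h1 _ G hsi β).trans ?_
            rw [hβm]
            -- As `s / ρ ≤ 1` and `m ≥ 2`, the quadratic factor can be extracted uniformly in `m`.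
            calc s ^ m = ρ ^ m * (s / ρ) ^ m := by
                  rw [← mul_pow, mul_div_cancel₀ _ hρ.ne']
              _ ≤ ρ ^ m * (s / ρ) ^ 2 := by
                  refine mul_le_mul_of_nonneg_left ?_ (by positivity)
                  exact pow_le_pow_of_le_one (by positivity) ((div_le_one hρ).2 hsρ)
                    (mem_Ico.1 hm).1
    have hbsum : ∑ N ∈ range (M + 1), b N ≤ r + K * (s / ρ) ^ 2 := by
      calc ∑ N ∈ range (M + 1), b N
          ≤ ∑ N ∈ range (M + 1), ((if N = 0 then ∑ i, ν (w i 0) else 0)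
              + ∑ i, ν (higherTerm h G N i)) := by
            refine sum_le_sum fun N _ => ?_
            refine (sum_le_sum fun j _ => map_add_le_add ν _ _).trans_eq ?_
            rw [sum_add_distrib]
            split_ifs <;> simp
        _ ≤ r + K * (s / ρ) ^ 2 := by
            rw [sum_add_distrib]
            refine add_le_add ?_ hhigh
            simpa using hr
    simp_rw [partialNorm]
    rw [sum_comm, sum_range_succ']
    simp only [hG.coeff_zero, map_zero, sum_const_zero, add_zero]
    refine (sum_le_sum fun N _ => hstep N).trans ?_
    refine (sum_antidiagonal_mul_le ha hb _).trans ?_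
    refine le_trans ?_ hle
    exact mul_le_mul (hC _) hbsum (sum_nonneg fun _ _ => hb _) hC0

/-- Without inhomogeneous term the bound holds with `r = s = 0`. -/
theorem IsSolution.partialNorm_le_zero {h : Fin n → (Fin n → ℕ) → ℂ}
    {w : Fin n → (Fin n → ℕ) → R} {G : Fin n → R⟦X⟧} (hG : IsSolution w G)
    (hw : ∀ i β, β ≠ 0 → w i β = algebraMap ℂ R (h i β)) (h1 : ν 1 ≤ 1)
    (hν : ∀ (c : ℂ) x, ν (c • x) ≤ ‖c‖ * ν x) {C K ρ : ℝ}
    (hC : ∀ M, ∑ k ∈ range M, ∑ i, ∑ j, ‖(linearPart h ^ k) i j‖ ≤ C)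
    (hK : ∀ M, ∑ i, ∑ m ∈ Ico 2 M, ∑ β ∈ piAntidiag univ m, ‖h i β‖ * ρ ^ m ≤ K)
    (hρ : 0 < ρ) (hw0 : ∀ i, w i 0 = 0) (i : Fin n) (M : ℕ) : partialNorm ν M (G i) ≤ 0 :=
  (single_le_sum (f := fun i => partialNorm ν M (G i)) (fun _ _ => partialNorm_nonneg _ _)
    (mem_univ i)).trans (hG.partialNorm_le hw h1 hν (r := 0) hC (by simp [hw0]) hK le_rfl hρ hρ.le
      (by simp) M)

end SeriesInversion

/-! ### Summation at `t = 1`, for numerical and for polynomial coefficients -/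

namespace SeriesInversion

open Finset PowerSeries

variable {n : ℕ}

theorem partialNorm_map_le {R S : Type*} [CommRing R] [CommRing S] {ν : RingSeminorm R}
    {ν' : RingSeminorm S} {φ : R →+* S} (h : ∀ x, ν' (φ x) ≤ ν x) (M : ℕ) (f : R⟦X⟧) :
    partialNorm ν' M (PowerSeries.map φ f) ≤ partialNorm ν M f :=
  sum_le_sum fun N _ => by simpa only [coeff_map] using h _

theorem summable_of_partialNorm_le {R : Type*} [CommRing R] {ν : RingSeminorm R} {f : R⟦X⟧} {s : ℝ}
    (h : ∀ M, partialNorm ν M f ≤ s) : Summable fun N => ν (coeff N f) :=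
  summable_of_sum_range_le (fun _ => apply_nonneg _ _) h

section Numeric

theorem IsSolution.coeff_prod_eq_zero {R : Type*} [CommRing R] {w : Fin n → (Fin n → ℕ) → R}
    {G : Fin n → R⟦X⟧} (hG : IsSolution w G) {N : ℕ} {β : Fin n → ℕ} (h : N < ∑ l, β l) :
    coeff N (∏ l, G l ^ β l) = 0 := by
  have hd : (X : R⟦X⟧) ^ (∑ l, β l) ∣ ∏ l, G l ^ β l := by
    rw [← prod_pow_eq_pow_sum]
    refine prod_dvd_prod_of_dvd _ _ fun l _ => pow_dvd_pow_of_dvd ?_ _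
    rw [X_dvd_iff, ← coeff_zero_eq_constantCoeff_apply]
    exact hG.coeff_zero l
  exact X_pow_dvd_iff.1 hd N h

theorem tsum_coeff_mul {f g : ℂ⟦X⟧} (hf : Summable fun N => ‖coeff N f‖)
    (hg : Summable fun N => ‖coeff N g‖) :
    ∑' N, coeff N (f * g) = (∑' N, coeff N f) * ∑' N, coeff N g := by
  rw [tsum_mul_tsum_eq_tsum_sum_antidiagonal_of_summable_norm hf hg]
  simp_rw [coeff_mul]

theorem summable_norm_coeff_mul {f g : ℂ⟦X⟧} (hf : Summable fun N => ‖coeff N f‖)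
    (hg : Summable fun N => ‖coeff N g‖) : Summable fun N => ‖coeff N (f * g)‖ := by
  simpa only [coeff_mul] using summable_norm_sum_mul_antidiagonal_of_summable_norm hf hg

theorem summable_norm_coeff_one : Summable fun N => ‖coeff N (1 : ℂ⟦X⟧)‖ :=
  summable_of_ne_finset_zero (s := {0}) fun N hN => by
    rw [coeff_one, if_neg (by simpa using hN), norm_zero]

theorem tsum_coeff_one : ∑' N, coeff N (1 : ℂ⟦X⟧) = 1 := by
  simp_rw [coeff_one]
  exact tsum_ite_eq 0 _

theorem tsum_coeff_prod_pow {G : Fin n → ℂ⟦X⟧} (hG : ∀ i, Summable fun N => ‖coeff N (G i)‖)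
    (β : Fin n → ℕ) :
    ∑' N, coeff N (∏ l, G l ^ β l) = monom (fun i => ∑' N, coeff N (G i)) β := by
  have hpow : ∀ i k, (Summable fun N => ‖coeff N (G i ^ k)‖) ∧
      ∑' N, coeff N (G i ^ k) = (∑' N, coeff N (G i)) ^ k := by
    intro i k
    induction k with
    | zero => simpa only [pow_zero] using ⟨summable_norm_coeff_one, tsum_coeff_one⟩
    | succ k ih =>
      simp only [pow_succ]
      exact ⟨summable_norm_coeff_mul ih.1 (hG i), by rw [tsum_coeff_mul ih.1 (hG i), ih.2]⟩
  have hprod : ∀ t : Finset (Fin n), (Summable fun N => ‖coeff N (∏ l ∈ t, G l ^ β l)‖) ∧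
      ∑' N, coeff N (∏ l ∈ t, G l ^ β l) = ∏ l ∈ t, (∑' N, coeff N (G l)) ^ β l := by
    intro t
    induction t using Finset.induction_on with
    | empty => simpa only [prod_empty] using ⟨summable_norm_coeff_one, tsum_coeff_one⟩
    | insert a t ha ih =>
      simp only [prod_insert ha]
      exact ⟨summable_norm_coeff_mul (hpow a _).1 ih.1,
        by rw [tsum_coeff_mul (hpow a _).1 ih.1, ih.2, (hpow a _).2]⟩
  exact (hprod univ).2

/-- Setting `t = 1` in the functional equation: the double series over `β` and the power of `t`
converges absolutely, so it may be summed in either order. -/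
theorem IsSolution.hasSum {w : Fin n → (Fin n → ℕ) → ℂ} {G : Fin n → ℂ⟦X⟧}
    (hG : IsSolution w G) {s : ℝ} (hs : ∀ i M, partialNorm (normRingSeminorm ℂ) M (G i) ≤ s)
    (hw : ∀ i, Summable fun β : Fin n → ℕ => ‖w i β‖ * s ^ ∑ l, β l) (i : Fin n) :
    HasSum (fun β => w i β * monom (fun j => ∑' N, coeff N (G j)) β) (∑' N, coeff N (G i)) := by
  have hGs : ∀ j, Summable fun N => ‖coeff N (G j)‖ := fun j => summable_of_partialNorm_le (hs j)
  have hβ : ∀ (β : Fin n → ℕ) M,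
      partialNorm (normRingSeminorm ℂ) M (∏ l, G l ^ β l) ≤ s ^ ∑ l, β l := fun β M =>
    partialNorm_prod_pow_le (norm_one (α := ℂ)).le M G (fun i => hs i M) β
  have hβs : ∀ β : Fin n → ℕ, Summable fun N => ‖coeff N (∏ l, G l ^ β l)‖ := fun β =>
    summable_of_partialNorm_le (hβ β)
  have hsum : Summable fun p : (Fin n → ℕ) × ℕ =>
      w i p.1 * coeff p.2 (∏ l, G l ^ p.1 l) := by
    refine Summable.of_norm ?_
    rw [summable_prod_of_nonneg fun _ => norm_nonneg _]
    simp_rw [norm_mul]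
    refine ⟨fun β => (hβs β).mul_left _, ?_⟩
    simp_rw [tsum_mul_left]
    refine Summable.of_nonneg_of_le (fun β => by positivity) (fun β => ?_) (hw i)
    refine mul_le_mul_of_nonneg_left ?_ (norm_nonneg _)
    exact Real.tsum_le_of_sum_range_le (fun _ => norm_nonneg _) (hβ β)
  -- The truncation at degree `N` is harmless: `t` divides each `G l`, so terms of larger degree
  -- vanish.
  have hcoeff : ∀ N, coeff (N + 1) (G i) = ∑' β, w i β * coeff N (∏ l, G l ^ β l) := by
    intro N
    rw [hG.coeff_succ, ← sum_biUnion, tsum_eq_sum]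
    · intro β hβ
      rw [hG.coeff_prod_eq_zero, mul_zero]
      by_contra! hlt
      exact hβ (mem_biUnion.2 ⟨∑ l, β l, by simpa using hlt, by simp⟩)
    · intro a _ b _ hab
      refine disjoint_left.2 fun β ha hb => hab ?_
      rw [← (mem_piAntidiag.1 ha).1, (mem_piAntidiag.1 hb).1]
  have hy : ∑' N, coeff N (G i) = ∑' N, ∑' β, w i β * coeff N (∏ l, G l ^ β l) := by
    rw [(hGs i).of_norm.tsum_eq_zero_add, hG.coeff_zero, zero_add]
    simp_rw [hcoeff]
  have h1 := hsum.hasSum.prod_fiberwise (fun β => ((hβs β).of_norm.mul_left (w i β)).hasSum)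
  simp_rw [tsum_mul_left, tsum_coeff_prod_pow hGs] at h1
  rw [hy]
  convert h1 using 1
  rw [hsum.tsum_prod]
  exact Summable.tsum_comm (f := fun β N => w i β * coeff N (∏ l, G l ^ β l)) hsum

end Numeric

section WeightedNorm

open MvPolynomial (monomial)

/-- The sum of the norms of the coefficients, weighted by powers of `r`. -/
noncomputable def weightedNorm (r : ℝ) (p : MvPolynomial (Fin n) ℂ) : ℝ :=
  ∑ α ∈ p.support, ‖p.coeff α‖ * r ^ α.degree

theorem weightedNorm_eq_sum {r : ℝ} {p : MvPolynomial (Fin n) ℂ} {S : Finset (Fin n →₀ ℕ)}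
    (h : p.support ⊆ S) : weightedNorm r p = ∑ α ∈ S, ‖p.coeff α‖ * r ^ α.degree := by
  refine sum_subset h fun α _ hα => ?_
  rw [MvPolynomial.notMem_support_iff.1 hα, norm_zero, zero_mul]

theorem weightedNorm_monomial (r : ℝ) (α : Fin n →₀ ℕ) (c : ℂ) :
    weightedNorm r (monomial α c) = ‖c‖ * r ^ α.degree := by
  rw [weightedNorm_eq_sum MvPolynomial.support_monomial_subset]
  simp

theorem weightedNorm_zero (r : ℝ) : weightedNorm r (0 : MvPolynomial (Fin n) ℂ) = 0 := by
  simp [weightedNorm]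

variable {r : ℝ}

theorem weightedNorm_add_le (hr : 0 ≤ r) (p q : MvPolynomial (Fin n) ℂ) :
    weightedNorm r (p + q) ≤ weightedNorm r p + weightedNorm r q := by
  classical
  rw [weightedNorm_eq_sum (MvPolynomial.support_add (p := p) (q := q)),
    weightedNorm_eq_sum (p := p) subset_union_left,
    weightedNorm_eq_sum (p := q) subset_union_right, ← sum_add_distrib]
  refine sum_le_sum fun α _ => ?_
  rw [MvPolynomial.coeff_add, ← add_mul]
  exact mul_le_mul_of_nonneg_right (norm_add_le _ _) (by positivity)

theorem weightedNorm_sum_le (hr : 0 ≤ r) {ι : Type*} (t : Finset ι)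
    (f : ι → MvPolynomial (Fin n) ℂ) :
    weightedNorm r (∑ a ∈ t, f a) ≤ ∑ a ∈ t, weightedNorm r (f a) :=
  le_sum_of_subadditive _ (weightedNorm_zero r).le (weightedNorm_add_le hr) t f

theorem weightedNorm_mul_le (hr : 0 ≤ r) (p q : MvPolynomial (Fin n) ℂ) :
    weightedNorm r (p * q) ≤ weightedNorm r p * weightedNorm r q := by
  conv_lhs => rw [MvPolynomial.as_sum p, MvPolynomial.as_sum q, sum_mul_sum]
  refine (weightedNorm_sum_le hr _ _).trans ?_
  rw [weightedNorm, weightedNorm, sum_mul_sum]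
  refine sum_le_sum fun α _ => (weightedNorm_sum_le hr _ _).trans_eq (sum_congr rfl fun β _ => ?_)
  rw [MvPolynomial.monomial_mul, weightedNorm_monomial, norm_mul, map_add, pow_add]
  ring

/-- `weightedNorm` as a ring seminorm. -/
noncomputable def weightedSeminorm (n : ℕ) (r : ℝ) (hr : 0 ≤ r) :
    RingSeminorm (MvPolynomial (Fin n) ℂ) where
  toFun := weightedNorm r
  map_zero' := weightedNorm_zero r
  add_le' := weightedNorm_add_le hr
  neg' p := by simp [weightedNorm, MvPolynomial.support_neg]
  mul_le' := weightedNorm_mul_le hr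

theorem weightedSeminorm_apply (hr : 0 ≤ r) (p : MvPolynomial (Fin n) ℂ) :
    weightedSeminorm n r hr p = weightedNorm r p := rfl

theorem weightedNorm_smul_le (c : ℂ) (p : MvPolynomial (Fin n) ℂ) :
    weightedNorm r (c • p) ≤ ‖c‖ * weightedNorm r p := by
  rw [weightedNorm_eq_sum (MvPolynomial.support_smul (a := c) (f := p)), weightedNorm, mul_sum]
  refine (sum_congr rfl fun α _ => ?_).le
  rw [MvPolynomial.coeff_smul, norm_smul, mul_assoc]

theorem norm_monom_le {x : Fin n → ℂ} (hx : ∀ l, ‖x l‖ ≤ r) (α : Fin n → ℕ) :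
    ‖monom x α‖ ≤ r ^ ∑ l, α l := by
  rw [monom, norm_prod, ← prod_pow_eq_pow_sum]
  refine prod_le_prod (fun _ _ => norm_nonneg _) fun l _ => ?_
  rw [norm_pow]
  exact pow_le_pow_left₀ (norm_nonneg _) (hx l) _

theorem eval_eq_sum_monom (x : Fin n → ℂ) (p : MvPolynomial (Fin n) ℂ) :
    MvPolynomial.eval x p = ∑ α ∈ p.support, p.coeff α * monom x α := by
  rw [MvPolynomial.eval_eq']
  rfl

theorem norm_eval_le {x : Fin n → ℂ} (hx : ∀ l, ‖x l‖ ≤ r) (p : MvPolynomial (Fin n) ℂ) :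
    ‖MvPolynomial.eval x p‖ ≤ weightedNorm r p := by
  rw [eval_eq_sum_monom]
  refine (norm_sum_le _ _).trans (sum_le_sum fun α _ => ?_)
  rw [norm_mul, Finsupp.degree_eq_sum]
  exact mul_le_mul_of_nonneg_left (norm_monom_le hx _) (norm_nonneg _)

theorem summable_coeff (hr : 0 < r) {f : (MvPolynomial (Fin n) ℂ)⟦X⟧}
    (hf : Summable fun N => weightedNorm r (coeff N f)) (α : Fin n →₀ ℕ) :
    Summable fun N => (coeff N f).coeff α := by
  refine Summable.of_norm_bounded (hf.mul_left (r ^ α.degree)⁻¹) fun N => ?_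
  rw [inv_mul_eq_div, le_div_iff₀ (by positivity)]
  by_cases hα : α ∈ (coeff N f).support
  · exact single_le_sum (f := fun α => ‖(coeff N f).coeff α‖ * r ^ α.degree)
      (fun _ _ => by positivity) hα
  · rw [MvPolynomial.notMem_support_iff.1 hα, norm_zero, zero_mul]
    exact sum_nonneg fun _ _ => by positivity

/-- The weighted norm dominates the sum of the absolute values of all monomials on the polydisc of
radius `r`, so the sums over `N` and over `α` commute. -/
theorem hasSum_tsum_coeff_mul_monom (hr : 0 < r) {f : (MvPolynomial (Fin n) ℂ)⟦X⟧}
    (hf : Summable fun N => weightedNorm r (coeff N f)) {x : Fin n → ℂ} (hx : ∀ l, ‖x l‖ ≤ r) :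
    HasSum (fun α : Fin n →₀ ℕ => (∑' N, (coeff N f).coeff α) * monom x α)
      (∑' N, MvPolynomial.eval x (coeff N f)) := by
  have hzero : ∀ N, ∀ α ∉ (coeff N f).support, (coeff N f).coeff α * monom x α = 0 := by
    intro N α hα
    rw [MvPolynomial.notMem_support_iff.1 hα, zero_mul]
  have hN : ∀ N, HasSum (fun α : Fin n →₀ ℕ => (coeff N f).coeff α * monom x α)
      (MvPolynomial.eval x (coeff N f)) := fun N => by
    rw [eval_eq_sum_monom]
    exact hasSum_sum_of_ne_finset_zero (hzero N)
  have hsum : Summable fun p : ℕ × (Fin n →₀ ℕ) => (coeff p.1 f).coeff p.2 * monom x p.2 := by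
    refine Summable.of_norm ?_
    rw [summable_prod_of_nonneg fun _ => norm_nonneg _]
    refine ⟨fun N => summable_of_ne_finset_zero (s := (coeff N f).support) fun α hα => by
      rw [hzero N α hα, norm_zero], ?_⟩
    refine Summable.of_nonneg_of_le (fun N => tsum_nonneg fun _ => norm_nonneg _) (fun N => ?_) hf
    rw [tsum_eq_sum (s := (coeff N f).support) fun α hα => by rw [hzero N α hα, norm_zero]]
    refine sum_le_sum fun α _ => ?_
    rw [norm_mul, Finsupp.degree_eq_sum]
    exact mul_le_mul_of_nonneg_left (norm_monom_le hx _) (norm_nonneg _)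
  have h1 := hsum.hasSum.prod_fiberwise hN
  have h2 := hsum.prod_symm.hasSum.prod_fiberwise
    fun α => ((summable_coeff hr hf α).mul_right (monom x α)).hasSum
  simp_rw [tsum_mul_right] at h2
  rw [h1.tsum_eq]
  convert h2 using 1
  exact ((Equiv.prodComm _ _).tsum_eq (fun p : ℕ × (Fin n →₀ ℕ) =>
    (coeff p.1 f).coeff p.2 * monom x p.2)).symm

end WeightedNorm

end SeriesInversion

/-! ### Neumann series, and analyticity of power series in several variables -/

namespace SeriesInversion

open Finset Filter Topology

variable {n : ℕ}

section Neumann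

open Matrix

theorem sum_norm_mul_le (A B : Matrix (Fin n) (Fin n) ℂ) :
    ∑ i, ∑ j, ‖(A * B) i j‖ ≤ (∑ i, ∑ j, ‖A i j‖) * ∑ i, ∑ j, ‖B i j‖ := by
  rw [sum_mul]
  refine sum_le_sum fun i _ => ?_
  calc ∑ j, ‖(A * B) i j‖ ≤ ∑ j, ∑ l, ‖A i l‖ * ‖B l j‖ := by
        refine sum_le_sum fun j _ => ?_
        rw [Matrix.mul_apply]
        exact (norm_sum_le _ _).trans_eq (by simp_rw [norm_mul])
    _ = ∑ l, ‖A i l‖ * ∑ j, ‖B l j‖ := by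
        rw [sum_comm]
        simp_rw [mul_sum]
    _ ≤ (∑ j, ‖A i j‖) * ∑ i, ∑ j, ‖B i j‖ := by
        rw [sum_mul]
        refine sum_le_sum fun l _ => mul_le_mul_of_nonneg_left ?_ (norm_nonneg _)
        exact single_le_sum (f := fun l => ∑ j, ‖B l j‖) (fun _ _ => by positivity) (mem_univ l)

theorem NeumannConverges.tendsto_pow {A : Matrix (Fin n) (Fin n) ℂ} (hA : NeumannConverges A) :
    Tendsto (fun k => A ^ k) atTop (𝓝 0) := by
  obtain ⟨S, hS⟩ := hA
  have h := (hS.comp (tendsto_add_atTop_nat 1)).sub hS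
  simpa [Function.comp_def, sum_range_succ] using h

theorem NeumannConverges.isUnit {A : Matrix (Fin n) (Fin n) ℂ} (hA : NeumannConverges A) :
    IsUnit (1 - A).det := by
  have h0 := hA.tendsto_pow
  obtain ⟨S, hS⟩ := hA
  have h1 : Tendsto (fun K => (1 - A) * ∑ k ∈ range K, A ^ k) atTop (𝓝 ((1 - A) * S)) :=
    hS.const_mul _
  simp_rw [mul_neg_geom_sum] at h1
  have h2 : (1 - A) * S = 1 := by
    refine tendsto_nhds_unique h1 ?_
    simpa using (tendsto_const_nhds (x := (1 : Matrix (Fin n) (Fin n) ℂ))).sub h0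
  exact Matrix.isUnit_det_of_right_inverse h2

/-- Convergence upgrades to absolute convergence. Since `A ^ k → 0`, some `A ^ L` has norm below `1
/ 2`; the partial sums `S M` of the norms then satisfy `S M ≤ S (L + M) ≤ S L + S M / 2`. -/
theorem NeumannConverges.exists_bound {A : Matrix (Fin n) (Fin n) ℂ} (hA : NeumannConverges A) :
    ∃ C : ℝ, ∀ M, ∑ k ∈ range M, ∑ i, ∑ j, ‖(A ^ k) i j‖ ≤ C := by
  have hlim : Tendsto (fun k => ∑ i, ∑ j, ‖(A ^ k) i j‖) atTop (𝓝 0) := by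
    have hc : Continuous fun B : Matrix (Fin n) (Fin n) ℂ => ∑ i, ∑ j, ‖B i j‖ := by fun_prop
    simpa [Function.comp_def] using (hc.tendsto 0).comp hA.tendsto_pow
  set a : ℕ → ℝ := fun k => ∑ i, ∑ j, ‖(A ^ k) i j‖ with ha
  have hpos : ∀ k, 0 ≤ a k := fun k => by positivity
  obtain ⟨L, hL⟩ := (hlim.eventually (gt_mem_nhds (show (0 : ℝ) < 1 / 2 by norm_num))).exists
  refine ⟨2 * ∑ k ∈ range L, a k, fun M => ?_⟩
  have h1 : ∑ k ∈ range M, a k ≤ ∑ k ∈ range (L + M), a k :=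
    sum_le_sum_of_subset_of_nonneg (range_subset_range.2 (by omega)) fun _ _ _ => hpos _
  have h2 : ∑ k ∈ range M, a (L + k) ≤ 1 / 2 * ∑ k ∈ range M, a k := by
    rw [mul_sum]
    refine sum_le_sum fun k _ => ?_
    simp only [ha, pow_add]
    exact (sum_norm_mul_le _ _).trans (mul_le_mul_of_nonneg_right hL.le (hpos k))
  rw [sum_range_add] at h1
  change ∑ k ∈ range M, a k ≤ _
  linarith

end Neumann

section Analytic

/-- The multilinear map `v ↦ ∏ k, v k (j k)`. -/
noncomputable def tupleMonomial {m : ℕ} (j : Fin m → Fin n) :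
    ContinuousMultilinearMap ℂ (fun _ : Fin m => Fin n → ℂ) ℂ :=
  (ContinuousMultilinearMap.mkPiAlgebra ℂ (Fin m) ℂ).compContinuousLinearMap
    fun k => ContinuousLinearMap.proj (j k)

theorem tupleMonomial_apply {m : ℕ} (j : Fin m → Fin n) (v : Fin m → Fin n → ℂ) :
    tupleMonomial j v = ∏ k, v k (j k) := by
  simp [tupleMonomial]

theorem norm_tupleMonomial_le {m : ℕ} (j : Fin m → Fin n) : ‖tupleMonomial j‖ ≤ 1 := by
  refine ContinuousMultilinearMap.opNorm_le_bound zero_le_one fun v => ?_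
  rw [tupleMonomial_apply, norm_prod, one_mul]
  exact prod_le_prod (fun _ _ => norm_nonneg _) fun k _ => norm_le_pi_norm _ _

open Classical in
/-- The formal multilinear series of the power series with coefficients `c`. -/
noncomputable def monomialSeries (c : (Fin n → ℕ) → ℂ) :
    FormalMultilinearSeries ℂ (Fin n → ℂ) ℂ :=
  fun m => ∑ j : Fin m → Fin n, if Monotone j then c (fiberCard j) • tupleMonomial j else 0

/-- The multilinear maps need not be symmetric, as only their diagonal values matter; hence each
coefficient may sit on its monotone tuple alone. -/
theorem monomialSeries_apply_diag (c : (Fin n → ℕ) → ℂ) (m : ℕ) (x : Fin n → ℂ) :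
    monomialSeries c m (fun _ => x) = ∑ β ∈ piAntidiag univ m, c β * monom x β := by
  rw [← sum_monotone_tuples, monomialSeries, _root_.sum_apply]
  refine sum_congr rfl fun j _ => ?_
  split_ifs
  · rw [_root_.smul_apply, tupleMonomial_apply, prod_comp_eq_prod_pow]
    rfl
  · rfl

theorem norm_monomialSeries_le (c : (Fin n → ℕ) → ℂ) (m : ℕ) :
    ‖monomialSeries c m‖ ≤ ∑ β ∈ piAntidiag univ m, ‖c β‖ := by
  rw [← sum_monotone_tuples (fun β => ‖c β‖)]
  refine (norm_sum_le _ _).trans (sum_le_sum fun j _ => ?_)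
  split_ifs
  · rw [norm_smul]
    exact mul_le_of_le_one_right (norm_nonneg _) (norm_tupleMonomial_le j)
  · simp

theorem hasSum_sum_piAntidiag {f : (Fin n → ℕ) → ℂ} {a : ℂ} (hf : HasSum f a) :
    HasSum (fun m => ∑ β ∈ piAntidiag univ m, f β) a := by
  have h := hf.tsum_fiberwise (fun β => ∑ l, β l)
  have hfib : ∀ m, (fun β : Fin n → ℕ => ∑ l, β l) ⁻¹' {m}
      = ↑(piAntidiag (univ : Finset (Fin n)) m) := by
    intro m
    ext β
    simp
  refine h.congr_fun fun m => ?_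
  rw [hfib, Finset.tsum_subtype']

theorem summable_mul_monom {c : (Fin n → ℕ) → ℂ} {r : ℝ}
    (hc : Summable fun β => ‖c β‖ * r ^ ∑ l, β l) {x : Fin n → ℂ} (hx : ∀ l, ‖x l‖ ≤ r) :
    Summable fun β => c β * monom x β := by
  refine Summable.of_norm_bounded hc fun β => ?_
  rw [norm_mul]
  exact mul_le_mul_of_nonneg_left (norm_monom_le hx β) (norm_nonneg _)

theorem hasFPowerSeriesOnBall_monomialSeries {c : (Fin n → ℕ) → ℂ} {r : NNReal} (hr : 0 < r)
    (hc : Summable fun β => ‖c β‖ * (r : ℝ) ^ ∑ l, β l) :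
    HasFPowerSeriesOnBall (fun x => ∑' β, c β * monom x β) (monomialSeries c) 0 r where
  r_le := by
    refine FormalMultilinearSeries.le_radius_of_bound _
      (∑' β, ‖c β‖ * (r : ℝ) ^ ∑ l, β l) fun m => ?_
    refine (mul_le_mul_of_nonneg_right (norm_monomialSeries_le c m) (by positivity)).trans ?_
    refine le_trans (le_of_eq ?_) (hc.sum_le_tsum (piAntidiag univ m) fun _ _ => by positivity)
    rw [sum_mul]
    exact sum_congr rfl fun β hβ => by rw [(mem_piAntidiag.1 hβ).1]
  r_pos := by simpa using hr
  hasSum := by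
    intro x hx
    simp_rw [monomialSeries_apply_diag, zero_add]
    refine hasSum_sum_piAntidiag (summable_mul_monom hc fun l => ?_).hasSum
    have : ‖x‖ < r := by simpa using hx
    exact (norm_le_pi_norm x l).trans this.le

theorem hasStrictFDerivAt_tsum_monom {c : (Fin n → ℕ) → ℂ} {r : ℝ} (hr : 0 < r)
    (hc : Summable fun β => ‖c β‖ * r ^ ∑ l, β l) :
    HasStrictFDerivAt (fun x => ∑' β, c β * monom x β)
      (∑ j, c (Pi.single j 1) • ContinuousLinearMap.proj (R := ℂ) (φ := fun _ : Fin n => ℂ) j)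
      0 := by
  lift r to NNReal using hr.le
  have h := (hasFPowerSeriesOnBall_monomialSeries (by exact_mod_cast hr)
    hc).hasFPowerSeriesAt.hasStrictFDerivAt
  refine h.congr_fderiv ?_
  ext1 x
  have hx : (continuousMultilinearCurryFin1 ℂ (Fin n → ℂ) ℂ (monomialSeries c 1)) x
      = monomialSeries c 1 fun _ => x := by
    rw [continuousMultilinearCurryFin1_apply]
    congr 1
  rw [hx, monomialSeries_apply_diag, sum_piAntidiag_one]
  simp only [_root_.sum_apply, _root_.smul_apply,
    ContinuousLinearMap.proj_apply, smul_eq_mul]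
  refine sum_congr rfl fun j _ => ?_
  rw [monom, prod_eq_single j] <;> simp +contextual

theorem analyticAt_tsum_monom {c : (Fin n → ℕ) → ℂ} {r : ℝ}
    (hc : Summable fun β => ‖c β‖ * r ^ ∑ l, β l) {x : Fin n → ℂ} (hx : ‖x‖ < r) :
    AnalyticAt ℂ (fun x => ∑' β, c β * monom x β) x := by
  have hr : 0 < r := (norm_nonneg x).trans_lt hx
  lift r to NNReal using hr.le
  exact (hasFPowerSeriesOnBall_monomialSeries (by exact_mod_cast hr) hc).analyticAt_of_mem
    (by simpa using hx)

end Analytic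

end SeriesInversion

/-! ### From a right inverse to the analytic local inverse -/

namespace SeriesInversion

open Finset Filter Topology

variable {n : ℕ}

theorem hasSum_ne_zero_iff {E : Type*} [AddCommMonoid E] [TopologicalSpace E]
    {f : (Fin n → ℕ) → E} {a : E} :
    HasSum (fun α : {α : Fin n → ℕ // α ≠ 0} => f α) a
      ↔ HasSum (fun α => if α = 0 then 0 else f α) a := by
  have := hasSum_subtype_iff_indicator (f := f) (a := a) (s := {α : Fin n → ℕ | α ≠ 0})
  refine this.trans (iff_of_eq ?_)
  congr 1
  funext α
  by_cases h : α = 0 <;> simp [h]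

/-- The coefficients of the non-constant terms, extended by zero. -/
def nonconst (c : (Fin n → ℕ) → ℂ) (α : Fin n → ℕ) : ℂ := if α = 0 then 0 else c α

theorem hasSum_nonconst_iff {c : (Fin n → ℕ) → ℂ} {x : Fin n → ℂ} {a : ℂ} :
    HasSum (fun α : {α : Fin n → ℕ // α ≠ 0} => c α * monom x α) a
      ↔ HasSum (fun α => nonconst c α * monom x α) a := by
  rw [hasSum_ne_zero_iff (f := fun α => c α * monom x α)]
  simp [nonconst, ite_mul]

theorem tsum_nonconst (c : (Fin n → ℕ) → ℂ) (x : Fin n → ℂ) :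
    ∑' α : {α : Fin n → ℕ // α ≠ 0}, c α * monom x α = ∑' α, nonconst c α * monom x α := by
  by_cases h : Summable fun α => nonconst c α * monom x α
  · exact (hasSum_nonconst_iff.2 h.hasSum).tsum_eq
  · rw [tsum_eq_zero_of_not_summable h, tsum_eq_zero_of_not_summable]
    rintro ⟨a, ha⟩
    exact h ⟨a, hasSum_nonconst_iff.1 ha⟩

theorem exists_polyradius {h : Fin n → (Fin n → ℕ) → ℂ} {U : Set (Fin n → ℂ)} (hU : IsOpen U)
    (h0 : 0 ∈ U) (hc : ConvergesOn h U) :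
    ∃ ρ : ℝ, 0 < ρ ∧ (∀ x : Fin n → ℂ, (∀ l, ‖x l‖ ≤ ρ) → x ∈ U) ∧
      ∀ i, Summable fun β => ‖nonconst (h i) β‖ * ρ ^ ∑ l, β l := by
  obtain ⟨ε, hε, hball⟩ := Metric.isOpen_iff.1 hU 0 h0
  have hmem : ∀ x : Fin n → ℂ, (∀ l, ‖x l‖ ≤ ε / 2) → x ∈ U := by
    intro x hx
    refine hball ?_
    rw [mem_ball_zero_iff]
    exact ((pi_norm_le_iff_of_nonneg (by positivity)).2 hx).trans_lt (by linarith)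
  refine ⟨ε / 2, by positivity, hmem, fun i => ?_⟩
  -- At a point with equal positive coordinates, the absolute values of the terms are exactly the
  -- weighted coefficients.
  have hs := hc (fun _ => ((ε / 2 : ℝ) : ℂ))
    (hmem _ fun l => by rw [Complex.norm_real, Real.norm_of_nonneg (by positivity)]) i
  obtain ⟨a, ha⟩ := hs
  have hn := (hasSum_nonconst_iff.1 ha).summable.norm
  refine hn.congr fun β => ?_
  rw [norm_mul, monom, prod_pow_eq_pow_sum, norm_pow, Complex.norm_real,
    Real.norm_of_nonneg (by positivity)]

theorem hasStrictFDerivAt_seriesMap {h : Fin n → (Fin n → ℕ) → ℂ} {ρ : ℝ} (hρ : 0 < ρ)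
    (hc : ∀ i, Summable fun β => ‖nonconst (h i) β‖ * ρ ^ ∑ l, β l) :
    HasStrictFDerivAt (seriesMap h)
      (LinearMap.toContinuousLinearMap (Matrix.toLin' (1 - linearPart h))) 0 := by
  refine hasStrictFDerivAt_pi'' fun i => ?_
  have h1 := (ContinuousLinearMap.proj (R := ℂ) (φ := fun _ : Fin n => ℂ) i).hasStrictFDerivAt
    (x := 0) |>.sub (hasStrictFDerivAt_tsum_monom hρ (hc i))
  have hfun : (fun x => seriesMap h x i)
      = fun x => ContinuousLinearMap.proj (R := ℂ) (φ := fun _ : Fin n => ℂ) i x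
        - ∑' β, nonconst (h i) β * monom x β := by
    funext x
    simp only [seriesMap, tsum_nonconst, ContinuousLinearMap.proj_apply]
  rw [hfun]
  refine h1.congr_fderiv ?_
  ext1 x
  simp [Matrix.mulVec, dotProduct, linearPart, nonconst]

/-- A right inverse of `F`, defined near the origin by convergent power series without constant
term, is the analytic local inverse of `F` if the derivative of `F` at the origin is invertible. -/
theorem hasAnalyticInverse_of_rightInverse {F : (Fin n → ℂ) → Fin n → ℂ} {U : Set (Fin n → ℂ)}
    {L : (Fin n → ℂ) ≃L[ℂ] Fin n → ℂ}
    (hF : HasStrictFDerivAt F (L : (Fin n → ℂ) →L[ℂ] Fin n → ℂ) 0)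
    {y : (Fin n → ℂ) → Fin n → ℂ} {g : Fin n → (Fin n → ℕ) → ℂ} {r : ℝ} (hr : 0 < r)
    (hg : ∀ i, Summable fun β => ‖nonconst (g i) β‖ * r ^ ∑ l, β l)
    (hy : ∀ x, ‖x‖ < r → ∀ i, HasSum (fun β => nonconst (g i) β * monom x β) (y x i))
    (hy0 : y 0 = 0) (hyU : ∀ x, ‖x‖ < r → y x ∈ U) (hFy : ∀ x, ‖x‖ < r → F (y x) = x) :
    HasAnalyticInverse F U g := by
  have hF0 : F 0 = 0 := by simpa [hy0] using hFy 0 (by simpa using hr)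
  have han : ∀ x, ‖x‖ < r → AnalyticAt ℂ y x := by
    intro x hx
    have h1 : AnalyticAt ℂ (fun x i => ∑' β, nonconst (g i) β * monom x β) x :=
      AnalyticAt.pi fun i => analyticAt_tsum_monom (hg i) hx
    refine h1.congr ?_
    filter_upwards [(continuous_norm.tendsto x).eventually (gt_mem_nhds hx)] with z hz
    funext i
    exact (hy z hz i).tsum_eq
  set e₀ := hF.toOpenPartialHomeomorph F with he₀
  have hsrc : ∀ᶠ x in 𝓝 (0 : Fin n → ℂ), y x ∈ e₀.source := by
    have hc := (han 0 (by simpa using hr)).continuousAt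
    refine hc.eventually (e₀.open_source.mem_nhds ?_)
    rw [hy0]
    exact hF.mem_toOpenPartialHomeomorph_source
  obtain ⟨δ, hδ, hδs⟩ := Metric.eventually_nhds_iff_ball.1 hsrc
  set V := Metric.ball (0 : Fin n → ℂ) (min δ r) with hV
  have hVr : ∀ x ∈ V, ‖x‖ < r := fun x hx => (mem_ball_zero_iff.1 hx).trans_le (min_le_right _ _)
  have hVs : ∀ x ∈ V, y x ∈ e₀.source := fun x hx =>
    hδs x (Metric.ball_subset_ball (min_le_left _ _) hx)
  -- A right inverse with values in the source, where `F` is injective, must be the inverse.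
  have hsymm : ∀ x ∈ V, e₀.symm x = y x := by
    intro x hx
    have h1 : e₀ (y x) = x := hFy x (hVr x hx)
    rw [← h1, e₀.left_inv (hVs x hx), h1]
  have hVt : ∀ x ∈ V, x ∈ e₀.target := by
    intro x hx
    have h1 : e₀ (y x) = x := hFy x (hVr x hx)
    rw [← h1]
    exact e₀.map_source (hVs x hx)
  set e := (e₀.symm.restrOpen V Metric.isOpen_ball).symm with he
  have het : ∀ x, x ∈ e.target ↔ x ∈ V := by
    intro x
    change x ∈ (e₀.symm.restrOpen V Metric.isOpen_ball).source ↔ _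
    rw [OpenPartialHomeomorph.restrOpen_source]
    exact ⟨fun h => h.2, fun h => ⟨hVt x h, h⟩⟩
  have hes : ∀ x ∈ e.target, e.symm x = y x := fun x hx => hsymm x ((het x).1 hx)
  have h0V : (0 : Fin n → ℂ) ∈ e.target := (het 0).2 (Metric.mem_ball_self (lt_min hδ hr))
  have heq : ∀ x, e x = F x := fun x => rfl
  refine ⟨e, ?_, ?_, fun x _ => heq x, by rw [heq, hF0], ?_, ?_⟩
  · rw [← hy0, ← hes 0 h0V]
    exact e.symm.map_source h0V
  · intro x hx
    have h1 := e.map_source hx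
    rw [← e.left_inv hx, hes _ h1]
    exact hyU _ (hVr _ ((het _).1 h1))
  · intro x hx
    refine (han x (hVr x ((het x).1 hx))).congr ?_
    filter_upwards [e.open_target.mem_nhds hx] with z hz
    exact (hes z hz).symm
  · intro x hx i
    rw [hes x hx, hasSum_nonconst_iff]
    exact hy x (hVr x ((het x).1 hx)) i

theorem sum_norm_mul_pow_le {h : Fin n → (Fin n → ℕ) → ℂ} {ρ : ℝ} (hρ : 0 < ρ)
    (hc : ∀ i, Summable fun β => ‖nonconst (h i) β‖ * ρ ^ ∑ l, β l) (M : ℕ) :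
    ∑ i, ∑ m ∈ Ico 2 M, ∑ β ∈ piAntidiag univ m, ‖h i β‖ * ρ ^ m
      ≤ ∑ i, ∑' β, ‖nonconst (h i) β‖ * ρ ^ ∑ l, β l := by
  refine sum_le_sum fun i _ => ?_
  have h1 : ∑ m ∈ Ico 2 M, ∑ β ∈ piAntidiag univ m, ‖h i β‖ * ρ ^ m
      = ∑ β ∈ (Ico 2 M).biUnion (piAntidiag univ), ‖nonconst (h i) β‖ * ρ ^ ∑ l, β l := by
    rw [sum_biUnion fun a _ b _ hab => disjoint_left.2 fun β ha hb => hab <| by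
      rw [← (mem_piAntidiag.1 ha).1, (mem_piAntidiag.1 hb).1]]
    refine sum_congr rfl fun m hm => sum_congr rfl fun β hβ => ?_
    have hβm : ∑ l, β l = m := (mem_piAntidiag.1 hβ).1
    have hβ0 : β ≠ 0 := by
      rintro rfl
      have := (mem_Ico.1 hm).1
      simp at hβm
      omega
    rw [nonconst, if_neg hβ0, hβm]
  rw [h1]
  exact (hc i).sum_le_tsum _ fun _ _ => by positivity

/-- `s` is so small that the quadratic term is at most `s / 2`, then `r` so small that the linear
one is too; the summands `1` keep the denominators positive. -/
theorem exists_radii {C K ρ : ℝ} (hC : 0 ≤ C) (hK : 0 ≤ K) (hρ : 0 < ρ) (n : ℕ) :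
    ∃ r s : ℝ, 0 < r ∧ 0 < s ∧ s ≤ ρ ∧ C * (n * r + K * (s / ρ) ^ 2) ≤ s := by
  set s : ℝ := min ρ (ρ ^ 2 / (2 * C * K + 1)) with hsdef
  have hs : 0 < s := lt_min hρ (by positivity)
  refine ⟨s / (2 * (C * n + 1)), s, by positivity, hs, min_le_left _ _, ?_⟩
  have h1 : C * (n * (s / (2 * (C * n + 1)))) ≤ s / 2 := by
    rw [← mul_assoc, mul_div_assoc', div_le_div_iff₀ (by positivity) (by positivity)]
    nlinarith
  have h2 : C * (K * (s / ρ) ^ 2) ≤ s / 2 := by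
    have h3 : s * (2 * C * K + 1) ≤ ρ ^ 2 := by
      rw [← le_div_iff₀ (by positivity)]
      exact min_le_right _ _
    rw [div_pow, mul_div_assoc', mul_div_assoc', div_le_div_iff₀ (by positivity) (by positivity)]
    nlinarith [mul_le_mul_of_nonneg_left h3 hs.le]
  linarith

/-! ### Inversion by a solution with polynomial coefficients -/

section Evaluation

theorem normRingSeminorm_apply (z : ℂ) : normRingSeminorm ℂ z = ‖z‖ := rfl

open PowerSeries

theorem partialNorm_le_of_sum_le {R : Type*} [CommRing R] {ν : RingSeminorm R} {G : Fin n → R⟦X⟧}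
    {M : ℕ} {s : ℝ} (h : ∑ i, partialNorm ν M (G i) ≤ s) (i : Fin n) :
    partialNorm ν M (G i) ≤ s :=
  (single_le_sum (f := fun i => partialNorm ν M (G i)) (fun _ _ => partialNorm_nonneg _ _)
    (mem_univ i)).trans h

theorem weightedNorm_one (r : ℝ) : weightedNorm r (1 : MvPolynomial (Fin n) ℂ) = 1 := by
  rw [← MvPolynomial.C_1, MvPolynomial.C_apply, weightedNorm_monomial]
  simp

theorem weightedNorm_X (r : ℝ) (i : Fin n) :
    weightedNorm r (MvPolynomial.X i : MvPolynomial (Fin n) ℂ) = r := by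
  rw [MvPolynomial.X, weightedNorm_monomial]
  simp

/-- The sum at `t = 1` of the series `G`, evaluated at `x`. -/
noncomputable def evalSum (G : Fin n → (MvPolynomial (Fin n) ℂ)⟦X⟧) (x : Fin n → ℂ) :
    Fin n → ℂ :=
  fun i => ∑' N, MvPolynomial.eval x (coeff N (G i))

/-- The coefficients in `x` of the sum at `t = 1` of the series `G`. -/
noncomputable def coeffSum (G : Fin n → (MvPolynomial (Fin n) ℂ)⟦X⟧) (i : Fin n)
    (α : Fin n → ℕ) : ℂ :=
  ∑' N, (coeff N (G i)).coeff (Finsupp.equivFunOnFinite.symm α)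

theorem hasSum_coeffSum {r : ℝ} (hr : 0 < r) {G : Fin n → (MvPolynomial (Fin n) ℂ)⟦X⟧}
    {i : Fin n} (hG : Summable fun N => weightedNorm r (coeff N (G i))) {x : Fin n → ℂ}
    (hx : ∀ l, ‖x l‖ ≤ r) :
    HasSum (fun α => coeffSum G i α * monom x α) (evalSum G x i) := by
  rw [← Finsupp.equivFunOnFinite.hasSum_iff]
  refine (hasSum_tsum_coeff_mul_monom hr hG hx).congr_fun fun α => ?_
  simp only [coeffSum, Function.comp_apply, Equiv.symm_apply_apply]
  rfl

variable {h : Fin n → (Fin n → ℕ) → ℂ} {w : Fin n → (Fin n → ℕ) → MvPolynomial (Fin n) ℂ}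
  {G : Fin n → (MvPolynomial (Fin n) ℂ)⟦X⟧}

theorem IsSolution.hasSum_nonconst (hG : IsSolution w G) (hw0 : ∀ i, w i 0 = MvPolynomial.X i)
    (hw : ∀ i β, β ≠ 0 → w i β = MvPolynomial.C (h i β)) {s ρ : ℝ} (hs : 0 ≤ s) (hsρ : s ≤ ρ)
    (hc : ∀ i, Summable fun β => ‖nonconst (h i) β‖ * ρ ^ ∑ l, β l) {x : Fin n → ℂ}
    (hx : ∀ i M,
      partialNorm (normRingSeminorm ℂ) M (PowerSeries.map (MvPolynomial.eval x) (G i)) ≤ s)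
    (i : Fin n) :
    HasSum (fun β => nonconst (h i) β * monom (evalSum G x) β) (evalSum G x i - x i) := by
  have hws : ∀ i, Summable fun β : Fin n → ℕ =>
      ‖MvPolynomial.eval x (w i β)‖ * s ^ ∑ l, β l := by
    intro i
    -- `nonconst` omits the index `0`, whose coefficient here is `x i`; it is added separately.
    refine ((hc i).add (summable_of_ne_finset_zero (s := {0})
      (f := fun β : Fin n → ℕ => if β = 0 then ‖x i‖ else 0) fun β hβ => ?_)).of_nonneg_of_le
      (fun β => by positivity) fun β => ?_
    · exact if_neg (by simpa using hβ)
    · by_cases hβ : β = 0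
      · simp [hβ, hw0, nonconst]
      · rw [hw i β hβ, MvPolynomial.eval_C, nonconst, if_neg hβ, if_neg hβ, add_zero]
        gcongr
  have h1 := (hG.map (MvPolynomial.eval x)).hasSum hx hws i
  simp only [coeff_map] at h1
  refine (h1.sub (hasSum_ite_eq (0 : Fin n → ℕ) (x i))).congr_fun fun β => ?_
  by_cases hβ : β = 0
  · simp [hβ, hw0, nonconst, monom]
  · rw [hw i β hβ, MvPolynomial.eval_C, nonconst, if_neg hβ, if_neg hβ, sub_zero]
    rfl

theorem evalSum_zero
    (hG : ∀ i M, partialNorm (normRingSeminorm ℂ) M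
      (PowerSeries.map (MvPolynomial.eval 0) (G i)) ≤ 0) :
    evalSum G 0 = 0 := by
  funext i
  refine (tsum_congr fun N => ?_).trans tsum_zero
  refine norm_le_zero_iff.1 (le_trans ?_ (hG i (N + 1)))
  exact single_le_sum (f := fun N => normRingSeminorm ℂ
    (coeff N (PowerSeries.map (MvPolynomial.eval 0) (G i)))) (fun _ _ => apply_nonneg _ _)
    (self_mem_range_succ N)

/-- The value of the power series at the origin is its constant coefficient. -/
theorem nonconst_coeffSum {r : ℝ} (hr : 0 < r) {i : Fin n}
    (hG : Summable fun N => weightedNorm r (coeff N (G i))) (h0 : evalSum G 0 = 0) :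
    nonconst (coeffSum G i) = coeffSum G i := by
  have hg0 : coeffSum G i 0 = 0 := by
    have h1 := hasSum_coeffSum hr hG (x := 0) fun _ => by simpa using hr.le
    rw [h0] at h1
    refine (hasSum_ite_eq (0 : Fin n → ℕ) (coeffSum G i 0)).unique (h1.congr_fun fun α => ?_)
    split_ifs with hα
    · simp [hα, monom]
    · obtain ⟨l, hl⟩ := Function.ne_iff.1 hα
      rw [monom, prod_eq_zero (mem_univ l) (by simpa using hl), mul_zero]
  funext α
  rw [nonconst]
  split_ifs with hα
  · rw [hα, hg0]
  · rfl

/-- A solution of the equation `G = t * (X + ∑ β, h β * G ^ β)` with polynomial coefficients sums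
up, at `t = 1`, to the analytic local inverse of `X - ∑ β, h β * X ^ β`. -/
theorem IsSolution.hasAnalyticInverse {U : Set (Fin n → ℂ)}
    (hU : IsOpen U) (h0 : 0 ∈ U) (hc : ConvergesOn h U) (hA : NeumannConverges (linearPart h))
    (hG : IsSolution w G) (hw0 : ∀ i, w i 0 = MvPolynomial.X i)
    (hw : ∀ i β, β ≠ 0 → w i β = MvPolynomial.C (h i β)) :
    (∀ i α, Summable fun N => (coeff N (G i)).coeff α) ∧
    HasAnalyticInverse (seriesMap h) U (coeffSum G) := by
  obtain ⟨ρ, hρ, hρU, hρs⟩ := exists_polyradius hU h0 hc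
  obtain ⟨C, hC⟩ := hA.exists_bound
  have hK := sum_norm_mul_pow_le hρ hρs
  obtain ⟨r, s, hr, hs, hsρ, hle⟩ := exists_radii (by simpa using hC 0) (by simpa using hK 0) hρ n
  have hGi : ∀ i M, partialNorm (weightedSeminorm n r hr.le) M (G i) ≤ s := by
    intro i M
    have hw' : ∀ i β, β ≠ 0 → w i β = algebraMap ℂ (MvPolynomial (Fin n) ℂ) (h i β) := by
      rwa [MvPolynomial.algebraMap_eq]
    have h1 : weightedSeminorm n r hr.le 1 ≤ 1 := by
      rw [weightedSeminorm_apply, weightedNorm_one]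
    have hsmul : ∀ (c : ℂ) (p : MvPolynomial (Fin n) ℂ),
        weightedSeminorm n r hr.le (c • p) ≤ ‖c‖ * weightedSeminorm n r hr.le p :=
      fun c p => by
        simp only [weightedSeminorm_apply]
        exact weightedNorm_smul_le c p
    have hX : ∑ i, weightedSeminorm n r hr.le (w i 0) ≤ n * r := by
      simp [hw0, weightedSeminorm_apply, weightedNorm_X]
    exact partialNorm_le_of_sum_le (hG.partialNorm_le hw' h1 hsmul hC hX hK hs.le hρ hsρ hle M) i
  have hGs : ∀ i, Summable fun N => weightedNorm r (coeff N (G i)) := by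
    intro i
    have h1 := summable_of_partialNorm_le (hGi i)
    simpa only [weightedSeminorm_apply] using h1
  have hev : ∀ x : Fin n → ℂ, (∀ l, ‖x l‖ ≤ r) → ∀ i M,
      partialNorm (normRingSeminorm ℂ) M (PowerSeries.map (MvPolynomial.eval x) (G i)) ≤ s :=
    fun x hx i M => by
      have h1 : ∀ p, normRingSeminorm ℂ (MvPolynomial.eval x p) ≤ weightedSeminorm n r hr.le p := by
        intro p
        rw [normRingSeminorm_apply, weightedSeminorm_apply]
        exact norm_eval_le hx p
      exact (partialNorm_map_le h1 M (G i)).trans (hGi i M)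
  -- At `x = 0` the equation becomes homogeneous, so the bound with `s = 0` annihilates the
  -- solution.
  have hy0 : evalSum G 0 = 0 := by
    refine evalSum_zero fun i M => ?_
    refine (hG.map (MvPolynomial.eval 0)).partialNorm_le_zero (h := h) ?_ ?_ ?_ hC hK hρ ?_ i M
    · intro i β hβ
      rw [hw i β hβ, MvPolynomial.eval_C]
      rfl
    · exact (norm_one (α := ℂ)).le
    · exact fun c z => (norm_smul c z).le
    · simp [hw0]
  have hnon : ∀ i, nonconst (coeffSum G i) = coeffSum G i := fun i =>
    nonconst_coeffSum hr (hGs i) hy0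
  have hle_r : ∀ x : Fin n → ℂ, ‖x‖ < r → ∀ l, ‖x l‖ ≤ r :=
    fun x hx l => (norm_le_pi_norm x l).trans hx.le
  obtain ⟨L, hL⟩ : ∃ L : (Fin n → ℂ) ≃L[ℂ] Fin n → ℂ, (L : (Fin n → ℂ) →L[ℂ] Fin n → ℂ)
      = LinearMap.toContinuousLinearMap (Matrix.toLin' (1 - linearPart h)) :=
    ⟨(Matrix.toLinearEquiv' _ (Matrix.invertibleOfIsUnitDet _ hA.isUnit)).toContinuousLinearEquiv,
      rfl⟩
  refine ⟨fun i α => summable_coeff hr (hGs i) α,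
    hasAnalyticInverse_of_rightInverse (L := L) (y := evalSum G) ?_ hr ?_ ?_ hy0 ?_ ?_⟩
  · rw [hL]
    exact hasStrictFDerivAt_seriesMap hρ hρs
  · intro i
    have h1 := (hasSum_coeffSum hr (hGs i) (x := fun _ => (r : ℂ))
      fun _ => by simp [abs_of_pos hr]).summable.norm
    refine h1.congr fun β => ?_
    rw [hnon, norm_mul, monom, prod_pow_eq_pow_sum, norm_pow, Complex.norm_real,
      Real.norm_of_nonneg hr.le]
  · intro x hx i
    rw [hnon]
    exact hasSum_coeffSum hr (hGs i) (hle_r x hx)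
  -- The values satisfy `‖y x l‖ ≤ s ≤ ρ`, so they stay in the polydisc contained in `U`.
  · intro x hx
    refine hρU _ fun l => ?_
    refine (tsum_of_norm_bounded (hGs l).hasSum fun N => norm_eval_le (hle_r x hx) _).trans ?_
    refine le_trans ?_ hsρ
    exact Real.tsum_le_of_sum_range_le
      (fun N => apply_nonneg (weightedSeminorm n r hr.le) (coeff N (G l))) (hGi l)
  · intro x hx
    funext i
    have h1 := hG.hasSum_nonconst hw0 hw hs.le hsρ hρs (hev x (hle_r x hx)) i
    rw [seriesMap, tsum_nonconst, h1.tsum_eq]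
    ring

end Evaluation

end SeriesInversion

/-! ### Tree weights for ordered and unordered trees -/

namespace SeriesInversion

open Finset PowerSeries TypedTree

variable {n : ℕ}

/-- The monomial `X ^ α` as a polynomial. -/
noncomputable def polyMonom (α : Fin n → ℕ) : MvPolynomial (Fin n) ℂ :=
  ∏ l, MvPolynomial.X l ^ α l

theorem polyMonom_single (i : Fin n) : polyMonom (Pi.single i 1) = MvPolynomial.X i := by
  rw [polyMonom, prod_eq_single i] <;> simp +contextual

theorem polyMonom_sum {ι : Type*} (s : Finset ι) (f : ι → Fin n → ℕ) :
    polyMonom (∑ k ∈ s, f k) = ∏ k ∈ s, polyMonom (f k) := by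
  simp only [polyMonom]
  rw [prod_comm]
  simp [prod_pow_eq_pow_sum]

theorem coeff_C_mul_polyMonom (α β : Fin n → ℕ) (a : ℂ) :
    (MvPolynomial.C a * polyMonom β).coeff (Finsupp.equivFunOnFinite.symm α)
      = if β = α then a else 0 := by
  have h1 : polyMonom β = MvPolynomial.monomial (Finsupp.equivFunOnFinite.symm β) 1 := by
    rw [MvPolynomial.monomial_eq, Finsupp.prod_fintype _ _ (by simp)]
    simp [polyMonom]
  rw [h1, MvPolynomial.C_mul_monomial, MvPolynomial.coeff_monomial, mul_one]
  simp only [EmbeddingLike.apply_eq_iff_eq]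

/-- The weight of a leaf of type `i` is the variable `X i`, that of an internal vertex is given
by `c`. -/
noncomputable def polyWeight (c : Fin n → ∀ m, (Fin m → Fin n) → ℂ) (i : Fin n) (m : ℕ)
    (j : Fin m → Fin n) : MvPolynomial (Fin n) ℂ :=
  if m = 0 then MvPolynomial.X i else MvPolynomial.C (c i m j)

/-- The coefficients of the equation solved by the series of trees. -/
noncomputable def polyCoeff (h : Fin n → (Fin n → ℕ) → ℂ) (i : Fin n) (β : Fin n → ℕ) :
    MvPolynomial (Fin n) ℂ :=
  if β = 0 then MvPolynomial.X i else MvPolynomial.C (h i β)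

theorem isSolution_polyWeight {c : Fin n → ∀ m, (Fin m → Fin n) → ℂ} {h : Fin n → (Fin n → ℕ) → ℂ}
    (hc : ∀ i m, ∀ β ∈ piAntidiag univ m, ∑ j with fiberCard j = β, c i m j = h i β) :
    IsSolution (polyCoeff h) (treeSeries (polyWeight c)) := by
  refine isSolution_treeSeries fun i m β hβ => ?_
  rcases Nat.eq_zero_or_pos m with rfl | hm
  · have hβ0 : β = 0 := by simpa using hβ
    have hf : ∀ j : Fin 0 → Fin n, fiberCard j = 0 := fun j => by
      funext l
      simp [fiberCard]
    simp [polyWeight, polyCoeff, hβ0, hf]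
  · have hβ0 : β ≠ 0 := by
      rintro rfl
      simp at hβ
      omega
    simp only [polyWeight, polyCoeff, hm.ne', hβ0, if_false]
    rw [← map_sum, hc i m β hβ]

/-- The analytic inverse has tree sums as coefficients, for any way to distribute the coefficients
`h i β` over the orderings of the types of the children of a vertex. -/
theorem hasTreeSum_and_hasAnalyticInverse {h : Fin n → (Fin n → ℕ) → ℂ} {U : Set (Fin n → ℂ)}
    (hU : IsOpen U) (h0 : 0 ∈ U) (hconv : ConvergesOn h U)
    (hA : NeumannConverges (linearPart h)) {c : Fin n → ∀ m, (Fin m → Fin n) → ℂ}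
    (hc : ∀ i m, ∀ β ∈ piAntidiag univ m, ∑ j with fiberCard j = β, c i m j = h i β)
    {S : Fin n → (Fin n → ℕ) → Set (TypedTree n)} {P : TypedTree n → Prop}
    (hS : ∀ i α T, T ∈ S i α ↔ P T ∧ T.rootType = i ∧ T.leafType = α)
    {w : Fin n → (Fin n → ℕ) → ℂ}
    (hw : ∀ T, P T → T.vertexProd (polyWeight c)
      = MvPolynomial.C (T.weight w) * polyMonom T.leafType)
    (hw' : ∀ T, ¬ P T → T.vertexProd (polyWeight c) = 0) :
    ∃ g : Fin n → (Fin n → ℕ) → ℂ, (∀ i α, HasTreeSum (S i α) w (g i α)) ∧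
      HasAnalyticInverse (seriesMap h) U g := by
  obtain ⟨hsum, hinv⟩ := (isSolution_polyWeight hc).hasAnalyticInverse hU h0 hconv hA
    (fun i => if_pos rfl) (fun i β hβ => if_neg hβ)
  refine ⟨_, fun i α => ?_, hinv⟩
  -- The coefficient of `t ^ N * X ^ α` is the total weight of the trees in `S i α` with `N`
  -- vertices.
  refine (hsum i (Finsupp.equivFunOnFinite.symm α)).hasSum.congr_fun fun N => ?_
  classical
  rw [coeff_treeSeries, MvPolynomial.coeff_sum, sum_filter, sum_filter]
  refine sum_congr rfl fun T _ => ?_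
  simp only [hS]
  by_cases hP : P T
  · rw [hw T hP, coeff_C_mul_polyMonom, ← ite_and]
    simp [hP]
  · simp [hw' T hP, hP]

theorem vertexProd_polyWeight {c : Fin n → ∀ m, (Fin m → Fin n) → ℂ} {w : Fin n → (Fin n → ℕ) → ℂ}
    (hcw : ∀ i m (j : Fin m → Fin n), c i m j = w i (fiberCard j)) (T : TypedTree n) :
    T.vertexProd (polyWeight c) = MvPolynomial.C (T.weight w) * polyMonom T.leafType := by
  induction T with
  | node t m b ih =>
    rw [vertexProd, weight, leafType, polyWeight]
    split_ifs with hm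
    · subst hm
      simp [polyMonom_single]
    · simp_rw [ih, prod_mul_distrib, polyMonom_sum, hcw, map_mul, map_prod, mul_assoc]
      rfl

-- One non-monotone vertex contributes a factor zero, which removes exactly the trees that are not
-- ordered.
open Classical in
theorem vertexProd_polyWeight_monotone {c : Fin n → ∀ m, (Fin m → Fin n) → ℂ}
    {w : Fin n → (Fin n → ℕ) → ℂ}
    (hcw : ∀ i m (j : Fin m → Fin n), c i m j = if Monotone j then w i (fiberCard j) else 0)
    (T : TypedTree n) :
    T.vertexProd (polyWeight c)
      = if T.IsOrdered then MvPolynomial.C (T.weight w) * polyMonom T.leafType else 0 := by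
  induction T with
  | node t m b ih =>
    rw [vertexProd, weight, leafType, polyWeight, IsOrdered]
    split_ifs with hm ho ho
    · subst hm
      simp [polyMonom_single]
    · subst hm
      exact absurd ⟨Subsingleton.monotone _, fun k => k.elim0⟩ ho
    · simp_rw [ih, ho.2, if_true, prod_mul_distrib, polyMonom_sum, hcw, if_pos ho.1, map_mul,
        map_prod, mul_assoc]
      rfl
    · rw [hcw]
      split_ifs with hmono
      · obtain ⟨k, hk⟩ : ∃ k, ¬ (b k).IsOrdered := by
          by_contra! hall
          exact ho ⟨hmono, hall⟩
        rw [prod_eq_zero (mem_univ k) (by rw [ih, if_neg hk]), mul_zero]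
      · simp

theorem sum_monotone_fiberCard_eq {m : ℕ} {β : Fin n → ℕ} (hβ : β ∈ piAntidiag univ m)
    (f : (Fin n → ℕ) → ℂ) :
    (∑ j : Fin m → Fin n with fiberCard j = β,
      open Classical in if Monotone j then f (fiberCard j) else 0) = f β := by
  classical
  have h1 := sum_monotone_tuples (m := m) fun γ => if γ = β then f γ else 0
  rw [sum_ite_eq' (piAntidiag univ m) β, if_pos hβ] at h1
  rw [← h1, sum_filter]
  refine sum_congr rfl fun j _ => ?_
  split_ifs <;> rfl

/-- There are `m! / β!` tuples with count `β`, each contributing `f β / m!`. -/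
theorem sum_div_factorial_eq {m : ℕ} {β : Fin n → ℕ} (hβ : β ∈ piAntidiag univ m)
    (f : (Fin n → ℕ) → ℂ) :
    (∑ j : Fin m → Fin n with fiberCard j = β,
      f (fiberCard j) / ((∑ l, fiberCard j l).factorial : ℂ)) = f β / (multiFactorial β : ℂ) := by
  rw [sum_congr rfl (g := fun _ => f β / ((∑ l, β l).factorial : ℂ)) fun j hj => by
    rw [(mem_filter.1 hj).2], sum_const, card_fiberCard_eq hβ, nsmul_eq_mul]
  have h1 := Nat.multinomial_spec univ β
  have h2 : (multiFactorial β : ℂ) * (Nat.multinomial univ β : ℂ) = ((∑ l, β l).factorial : ℂ) := by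
    exact_mod_cast h1
  have h3 : ((∑ l, β l).factorial : ℂ) ≠ 0 := Nat.cast_ne_zero.2 (Nat.factorial_ne_zero _)
  have h4 : (multiFactorial β : ℂ) ≠ 0 := by
    intro h
    rw [h, zero_mul] at h2
    exact h3 h2.symm
  field_simp
  rw [← h2]
  ring

end SeriesInversion

theorem theorem2p1 :
    -- coefficients `h`, ordered trees
    (∀ (n : ℕ) (h : Fin n → (Fin n → ℕ) → ℂ) (U : Set (Fin n → ℂ)),
      IsOpen U → (0 : Fin n → ℂ) ∈ U → SeriesInversion.ConvergesOn h U →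
      SeriesInversion.NeumannConverges (SeriesInversion.linearPart h) →
      ∃ g : Fin n → (Fin n → ℕ) → ℂ,
        (∀ i α, TypedTree.HasTreeSum (TypedTree.orderedTrees i α) h (g i α)) ∧
        SeriesInversion.HasAnalyticInverse (SeriesInversion.seriesMap h) U g) ∧
    -- coefficients `H / α!`, unordered trees
    (∀ (n : ℕ) (H h : Fin n → (Fin n → ℕ) → ℂ) (U : Set (Fin n → ℂ)),
      (∀ i α, h i α = H i α / (SeriesInversion.multiFactorial α : ℂ)) →
      IsOpen U → (0 : Fin n → ℂ) ∈ U → SeriesInversion.ConvergesOn h U →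
      SeriesInversion.NeumannConverges (SeriesInversion.linearPart h) →
      ∃ g : Fin n → (Fin n → ℕ) → ℂ,
        (∀ i α, TypedTree.HasTreeSum (TypedTree.unorderedTrees i α)
          (fun j β => H j β / ((∑ l, β l).factorial : ℂ)) (g i α)) ∧
        SeriesInversion.HasAnalyticInverse (SeriesInversion.seriesMap h) U g) := by
  classical
  refine ⟨fun n h U hU h0 hconv hA => ?_, fun n H h U hh hU h0 hconv hA => ?_⟩
  · have hv := SeriesInversion.vertexProd_polyWeight_monotone (w := h)
      (c := fun i _ j => if Monotone j then h i (SeriesInversion.fiberCard j) else 0)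
      fun _ _ _ => rfl
    refine SeriesInversion.hasTreeSum_and_hasAnalyticInverse hU h0 hconv hA
      (c := fun i _ j => if Monotone j then h i (SeriesInversion.fiberCard j) else 0)
      (P := TypedTree.IsOrdered) (fun i m β hβ => ?_) (fun _ _ _ => Iff.rfl)
      (fun T hT => (hv T).trans (if_pos hT)) fun T hT => (hv T).trans (if_neg hT)
    exact SeriesInversion.sum_monotone_fiberCard_eq hβ (h i)
  · refine SeriesInversion.hasTreeSum_and_hasAnalyticInverse hU h0 hconv hA (P := fun _ => True)
      (fun i m β hβ => ?_) (fun _ _ _ => by simp [TypedTree.unorderedTrees])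
      (fun T _ => SeriesInversion.vertexProd_polyWeight (fun _ _ _ => rfl) T)
      fun T hT => absurd trivial hT
    rw [hh]
    exact SeriesInversion.sum_div_factorial_eq hβ (H i)
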